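/- A metric measure space $(X,d,\mathfrak m)$ is a complete separable metric space $(X,d)$ with a non-negative Borel measure $\mathfrak m$ that is finite on $d$-bounded sets. For a $d$-Lipschitz function $g\colon X\to\mathbb R$ let $$\mathrm{lip}_a^d(g)(x)=\inf_{r>0}\ \sup\Big\{\tfrac{|g(y)-g(z)|}{d(y,z)} : y\neq z,\ d(x,y)<r,\ d(x,z)<r\Big\}\qquad(\sup\emptyset:=0).$$ The asymptotic energy $\mathcal E_a^d\colon L^2(\mathfrak m)\to[0,+\infty]$ is $\mathcal E_a^d(f)=\inf_g\frac12\int \mathrm{lip}_a^d(g)^2\,d\mathfrak m$, where the infimum is over all $d$-Lipschitz functions $g$ with $d$-bounded support such that $g=f$ $\mathfrak m$-a.e. ($\inf\emptyset:=+\infty$). The Cheeger energy is its $L^2(\mathfrak m)$-lower semicontinuous envelope, $$\mathcal E_{\mathrm{Ch}}^d(f)=\inf\Big\{\liminf_{n\to\infty}\mathcal E_a^d(f_n) : f_n\to f \text{ in } L^2(\mathfrak m)\Big\}.$$ The space $(X,d,\mathfrak m)$ is infinitesimally Hilbertian if $W^{1,2}=\{f\in L^2(\mathfrak m):\mathcal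 E_{\mathrm{Ch}}^d(f)<\infty\}$, with the norm $\big(\|f\|_{L^2}^2+2\,\mathcal E_{\mathrm{Ch}}^d(f)\big)^{1/2}$, is a Hilbert space. **Corollary.** Let $(X,d,\mathfrak m)$ be a metric measure space and let $(d_i)_{i\in\mathbb N}$ be a sequence of complete distances on $X$, each inducing the same topology as $d$ and such that $\mathfrak m$ is finite on $d_i$-bounded sets (so that each $(X,d_i,\mathfrak m)$ is a metric measure space). Suppose that for all $x,y\in X$ the sequence $d_i(x,y)$ is non-decreasing in $i$ and converges to $d(x,y)$. If $(X,d_i,\mathfrak m)$ is infinitesimally Hilbertian for every $i\in\mathbb N$, then $(X,d,\mathfrak m)$ is infinitesimally Hilbertian. -/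

import Mathlib

open MeasureTheory Filter Topology
open scoped ENNReal

/-!  Metric measure spaces, the Cheeger 2-energy and infinitesimal Hilbertianity. Since several
distances on the same set have to be compared, the distance is an explicit argument
`d : MetricSpace X` everywhere. -/

namespace CheegerEnergy

/-- The topology induced by the distance `d`. -/
abbrev topologyOf {X : Type*} (d : MetricSpace X) : TopologicalSpace X :=
  d.toUniformSpace.toTopologicalSpace

/-- `(X, d, m)` is a metric measure space: `(X, d)` is complete and separable, and `m` is a
measure on the Borel sets that is finite on bounded sets. -/
structure IsMetricMeasureSpace {X : Type*} [MeasurableSpace X] (d : MetricSpace X)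
    (m : Measure X) : Prop where
  complete : CompleteSpace X
  separable : TopologicalSpace.SeparableSpace X
  borel : BorelSpace X
  finite_of_isBounded : ∀ s : Set X, Bornology.IsBounded s → m s < ∞

/-- The Lipschitz constant of `f` restricted to `E`
(equal to `0` when `E` has at most one point). -/
noncomputable def lipConst {X : Type*} (d : MetricSpace X) (f : X → ℝ) (E : Set X) : ℝ≥0∞ :=
  ⨆ (x ∈ E) (y ∈ E) (_ : x ≠ y), ENNReal.ofReal (|f x - f y| / d.dist x y)

/-- The asymptotic slope of `f` at `x`. -/
noncomputable def asymptoticSlope {X : Type*} (d : MetricSpace X) (f : X → ℝ) (x : X) : ℝ≥0∞ :=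
  ⨅ (r : ℝ) (_ : 0 < r), lipConst d f (Metric.ball x r)

/-- `f` is `d`-Lipschitz with `d`-bounded support. (The set where `f` does not vanish is
bounded if and only if its closure is.) -/
def IsBoundedlySupportedLipschitz {X : Type*} (d : MetricSpace X) (f : X → ℝ) : Prop :=
  (∃ K, LipschitzWith K f) ∧ Bornology.IsBounded (Function.support f)

/-- The asymptotic 2-energy on `L²(m)`: the value `½ ∫ lip_a(g)² dm` if the class `f` is
represented by a boundedly-supported Lipschitz function `g`, and `∞` if there is no such `g`.
When `m` does not have full support several `g` may represent the same class; the infimum over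
them is taken. -/
noncomputable def asymptoticEnergy {X : Type*} [MeasurableSpace X] (d : MetricSpace X)
    (m : Measure X) (f : Lp ℝ 2 m) : ℝ≥0∞ :=
  ⨅ (g : X → ℝ) (_ : IsBoundedlySupportedLipschitz d g) (_ : f =ᵐ[m] g),
    (1 / 2) * ∫⁻ x, asymptoticSlope d g x ^ 2 ∂m

/-- The Cheeger 2-energy: the `L²(m)`-lower semicontinuous envelope of the asymptotic
2-energy. -/
noncomputable def cheegerEnergy {X : Type*} [MeasurableSpace X] (d : MetricSpace X)
    (m : Measure X) (f : Lp ℝ 2 m) : ℝ≥0∞ :=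
  ⨅ (u : ℕ → Lp ℝ 2 m) (_ : Tendsto u atTop (𝓝 f)),
    liminf (fun n => asymptoticEnergy d m (u n)) atTop

/-- The norm of the Sobolev space `W^{1,2}`, whose underlying set is `{f | cheegerEnergy d m f < ∞}`.
It is only meaningful on this set. -/
noncomputable def sobolevNorm {X : Type*} [MeasurableSpace X] (d : MetricSpace X)
    (m : Measure X) (f : Lp ℝ 2 m) : ℝ :=
  Real.sqrt (‖f‖ ^ 2 + 2 * (cheegerEnergy d m f).toReal)

/-- `(X, d, m)` is infinitesimally Hilbertian: the finiteness domain `W^{1,2}` of the Cheeger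
2-energy is a linear subspace `W` of `L²(m)`, its Sobolev norm is induced by an inner product,
and `W` is complete for this norm. -/
def IsInfinitesimallyHilbertian {X : Type*} [MeasurableSpace X] (d : MetricSpace X)
    (m : Measure X) : Prop :=
  ∃ W : Submodule ℝ (Lp ℝ 2 m),
    (∀ f : Lp ℝ 2 m, f ∈ W ↔ cheegerEnergy d m f < ∞) ∧
    (∃ c : InnerProductSpace.Core ℝ W, ∀ f : W, sobolevNorm d m f ^ 2 = c.inner f f) ∧
    (∀ u : ℕ → W,
      (∀ ε : ℝ, 0 < ε → ∃ N, ∀ n ≥ N, ∀ k ≥ N, sobolevNorm d m (u n - u k) < ε) →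
      ∃ f : W, Tendsto (fun n => sobolevNorm d m (u n - f)) atTop (𝓝 0))

end CheegerEnergy

/-! Being infinitesimally Hilbertian amounts to a parallelogram law for the Cheeger energy, and such
a law survives a limit of Γ-convergence type. A larger distance has a smaller Cheeger energy
(`cheegerEnergy_anti`), so the energy of `d` lies below that of every `dseq i`. Conversely,
functions of finite `d`-energy are approximated in L² by functions whose `dseq i`-energy, for some
`i`, is hardly larger (`exists_asymptoticEnergy_dseq_lt`). Writing the Hilbertian identity of `dseq
i` for such approximants of `f` and `g`, and using lower semicontinuity on the left, gives an
inequality for the energy of `d`.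

The inequality carries a weight `s`: the case `s = 1` is the parallelogram law, `g = 0` gives
homogeneity, and the ratio of the two norms gives the triangle inequality. Hence
`exists_core_of_weighted_parallelogram_le` needs no separate convexity or homogeneity of the energy.
Completeness follows from lower semicontinuity.

The approximation is the hard point, since a `d`-Lipschitz function need not be Lipschitz for any
`dseq i`. On a compact set carrying almost all the relevant measure, Dini's theorem makes `dseq i`
uniformly close to `d`. There a finite minimum of `dseq i`-cones, whose slopes are local Lipschitz
constants of the function, has the right local slopes (`exists_discrete_infConvolution`). Its global
Lipschitz constant does not depend on `i`, so the rest of the space contributes little energy. -/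

namespace CheegerEnergy

/-! ### Local Lipschitz constants and asymptotic slopes. -/

section

variable {X : Type*}

/-- `h` is `Γ`-Lipschitz for the distance `e` on some ball centred at `x`. -/
def LipNear (e : MetricSpace X) (h : X → ℝ) (x : X) (Γ : ℝ) : Prop :=
  ∃ ρ > 0, ∀ y z, e.dist x y < ρ → e.dist x z < ρ → |h y - h z| ≤ Γ * e.dist y z

lemma lipConst_le_ofReal (d : MetricSpace X) {f : X → ℝ} {E : Set X} {L : ℝ}
    (h : ∀ x ∈ E, ∀ y ∈ E, |f x - f y| ≤ L * dist x y) : lipConst d f E ≤ ENNReal.ofReal L := by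
  refine iSup₂_le fun x hx => iSup₂_le fun y hy => iSup_le fun hxy => ?_
  exact ENNReal.ofReal_le_ofReal ((div_le_iff₀ (dist_pos.2 hxy)).2 (h x hx y hy))

lemma le_lipConst (d : MetricSpace X) (f : X → ℝ) {E : Set X} {x y : X} (hx : x ∈ E) (hy : y ∈ E)
    (hxy : x ≠ y) : ENNReal.ofReal (|f x - f y| / dist x y) ≤ lipConst d f E :=
  le_iSup₂_of_le x hx (le_iSup₂_of_le y hy (le_iSup_of_le hxy le_rfl))

lemma lipConst_mono (d : MetricSpace X) (f : X → ℝ) {E F : Set X} (h : E ⊆ F) :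
    lipConst d f E ≤ lipConst d f F :=
  iSup₂_le fun _ hx => iSup₂_le fun _ hy => iSup_le fun hxy => le_lipConst d f (h hx) (h hy) hxy

lemma abs_sub_le_toReal_lipConst (d : MetricSpace X) {f : X → ℝ} {E : Set X}
    (hE : lipConst d f E ≠ ∞) {x y : X} (hx : x ∈ E) (hy : y ∈ E) :
    |f x - f y| ≤ (lipConst d f E).toReal * dist x y := by
  rcases eq_or_ne x y with rfl | hxy
  · simp
  · rw [← div_le_iff₀ (dist_pos.2 hxy)]
    exact (ENNReal.ofReal_le_iff_le_toReal hE).1 (le_lipConst d f hx hy hxy)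

lemma LipNear.asymptoticSlope_le {e : MetricSpace X} {h : X → ℝ} {x : X} {Γ : ℝ}
    (H : LipNear e h x Γ) : asymptoticSlope e h x ≤ ENNReal.ofReal Γ := by
  obtain ⟨ρ, hρ, H⟩ := H
  refine iInf₂_le_of_le ρ hρ (lipConst_le_ofReal e fun y hy z hz => H y z ?_ ?_)
  · exact Metric.mem_ball'.1 hy
  · exact Metric.mem_ball'.1 hz

lemma asymptoticSlope_le_of_eqOn_ball {e : MetricSpace X} {h g : X → ℝ} {x : X} {ρ : ℝ}
    (hρ : 0 < ρ) (H : ∀ y, e.dist x y < ρ → h y = g y) :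
    asymptoticSlope e h x ≤ asymptoticSlope e g x := by
  refine le_iInf₂ fun r hr => iInf₂_le_of_le (min r ρ) (lt_min hr hρ) ?_
  refine iSup₂_le fun y hy => iSup₂_le fun z hz => iSup_le fun hyz => ?_
  rw [Metric.mem_ball'] at hy hz
  rw [H y (hy.trans_le (min_le_right _ _)), H z (hz.trans_le (min_le_right _ _))]
  exact le_lipConst e g (Metric.mem_ball'.2 (hy.trans_le (min_le_left _ _)))
    (Metric.mem_ball'.2 (hz.trans_le (min_le_left _ _))) hyz

lemma LipNear.congr {e : MetricSpace X} {h g : X → ℝ} {x : X} {Γ ρ : ℝ} (H : LipNear e g x Γ)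
    (hρ : 0 < ρ) (hgh : ∀ y, e.dist x y < ρ → h y = g y) : LipNear e h x Γ := by
  obtain ⟨r, hr, H⟩ := H
  refine ⟨min r ρ, lt_min hr hρ, fun y z hy hz => ?_⟩
  rw [hgh y (hy.trans_le (min_le_right _ _)), hgh z (hz.trans_le (min_le_right _ _))]
  exact H y z (hy.trans_le (min_le_left _ _)) (hz.trans_le (min_le_left _ _))

/-- Enlarging the distance decreases the asymptotic slope. -/
lemma asymptoticSlope_anti {d' d : MetricSpace X} (hdd : ∀ x y, d'.dist x y ≤ d.dist x y)
    (h : X → ℝ) (x : X) : asymptoticSlope d h x ≤ asymptoticSlope d' h x := by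
  refine le_iInf₂ fun r hr => iInf₂_le_of_le r hr ?_
  refine iSup₂_le fun y hy => iSup₂_le fun z hz => iSup_le fun hyz => ?_
  refine le_trans (ENNReal.ofReal_le_ofReal ?_) (le_lipConst d' h ?_ ?_ hyz)
  · exact div_le_div_of_nonneg_left (abs_nonneg _) (@dist_pos X d' y z |>.2 hyz) (hdd y z)
  · exact lt_of_le_of_lt (hdd y x) hy
  · exact lt_of_le_of_lt (hdd z x) hz

/-- A pair of points in an open ball remains in it when the centre moves slightly. This supplies the
measurability needed for dominated convergence. -/
lemma lowerSemicontinuous_lipConst_ball (d : MetricSpace X) (f : X → ℝ) (r : ℝ) :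
    LowerSemicontinuous fun x => lipConst d f (Metric.ball x r) := by
  intro x c hc
  simp only [lipConst, lt_iSup_iff] at hc
  obtain ⟨y, hy, z, hz, hyz, hc⟩ := hc
  rw [Metric.mem_ball'] at hy hz
  have h1 : ∀ᶠ x' in 𝓝 x, dist x' y < r :=
    (continuous_id.dist continuous_const).continuousAt.eventually_lt continuousAt_const hy
  have h2 : ∀ᶠ x' in 𝓝 x, dist x' z < r :=
    (continuous_id.dist continuous_const).continuousAt.eventually_lt continuousAt_const hz
  filter_upwards [h1, h2] with x' h1 h2
  exact hc.trans_le (le_lipConst d f (Metric.mem_ball'.2 h1) (Metric.mem_ball'.2 h2) hyz)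

lemma tendsto_lipConst_ball (d : MetricSpace X) (f : X → ℝ) (x : X) {r : ℕ → ℝ} (hr : ∀ n, 0 < r n)
    (hr' : Antitone r) (hlim : Tendsto r atTop (𝓝 0)) :
    Tendsto (fun n => lipConst d f (Metric.ball x (r n))) atTop (𝓝 (asymptoticSlope d f x)) := by
  have : asymptoticSlope d f x = ⨅ n, lipConst d f (Metric.ball x (r n)) := by
    refine le_antisymm (le_iInf fun n => iInf₂_le _ (hr n)) (le_iInf₂ fun s hs => ?_)
    obtain ⟨n, hn⟩ := (hlim.eventually (gt_mem_nhds hs)).exists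
    exact iInf_le_of_le n (lipConst_mono d f (Metric.ball_subset_ball hn.le))
  rw [this]
  exact tendsto_atTop_iInf fun a b hab => lipConst_mono d f (Metric.ball_subset_ball (hr' hab))

lemma isBoundedlySupportedLipschitz_of_abs_sub_le (e : MetricSpace X) {h : X → ℝ} {C R : ℝ}
    (hC : 0 ≤ C) (hh : ∀ x y, |h x - h y| ≤ C * dist x y) (x₀ : X)
    (hR : ∀ x, R < dist x₀ x → h x = 0) : IsBoundedlySupportedLipschitz e h := by
  refine ⟨⟨C.toNNReal, LipschitzWith.of_dist_le_mul fun x y => ?_⟩,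
    (Metric.isBounded_closedBall (x := x₀) (r := R)).subset fun x hx => ?_⟩
  · rw [Real.coe_toNNReal C hC]; exact hh x y
  · rw [Metric.mem_closedBall']
    by_contra hc
    exact hx (hR x (not_le.1 hc))

lemma IsBoundedlySupportedLipschitz.exists_bounds {d : MetricSpace X} {g : X → ℝ}
    (hg : IsBoundedlySupportedLipschitz d g) (x₀ : X) :
    ∃ L M R : ℝ, 0 ≤ L ∧ 0 ≤ M ∧ 0 ≤ R ∧ (∀ x y, |g x - g y| ≤ L * d.dist x y) ∧
      (∀ x, |g x| ≤ M) ∧ (∀ x, R < d.dist x₀ x → g x = 0) := by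
  obtain ⟨⟨K, hK⟩, hb⟩ := hg
  obtain ⟨R, hR⟩ := hb.subset_closedBall x₀
  have hL : ∀ x y, |g x - g y| ≤ K * d.dist x y := fun x y => hK.dist_le_mul x y
  have hz : ∀ x, max R 0 < d.dist x₀ x → g x = 0 := fun x hx => by
    by_contra hc
    have := hR (Function.mem_support.2 hc)
    rw [Metric.mem_closedBall'] at this
    exact absurd (hx.trans_le this) (not_lt.2 (le_max_left _ _))
  refine ⟨K, |g x₀| + K * max R 0, max R 0, K.2, by positivity, le_max_right _ _, hL,
    fun x => ?_, hz⟩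
  rcases lt_or_ge (max R 0) (d.dist x₀ x) with h | h
  · rw [hz x h, abs_zero]; positivity
  · have h1 := hL x₀ x
    have h2 : (K : ℝ) * d.dist x₀ x ≤ K * max R 0 := mul_le_mul_of_nonneg_left h K.2
    have h3 := abs_sub_abs_le_abs_sub (g x) (g x₀)
    rw [abs_sub_comm] at h3
    linarith

end

/-! ### Approximation by finitely many cones for a smaller distance. -/

section

variable {X : Type*}

/-- A function that is Lipschitz for `d` is approximated, on a compact set where the smaller
distance `e` is close to `d`, by an `e`-Lipschitz function whose local Lipschitz constants are
controlled by those of the given function at scale `4 * r`. -/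
lemma exists_discrete_infConvolution (d e : MetricSpace X) {K : Set X}
    (hK : @TotallyBounded X d.toUniformSpace K) (hne : K.Nonempty)
    (hed : ∀ x y, e.dist x y ≤ d.dist x y)
    {g : X → ℝ} {L : ℝ} (hL : 0 ≤ L) (hg : ∀ x y, |g x - g y| ≤ L * d.dist x y)
    {ε r : ℝ} (hε : 0 < ε) (hε1 : ε ≤ 1) (hr : 0 < r) (hr1 : r ≤ 1)
    (hde : ∀ x ∈ K, ∀ y ∈ K, d.dist x y ≤ e.dist x y + ε * r / 2) :
    ∃ F : X → ℝ, (∀ y z, |F y - F z| ≤ (6 * L + 1) * e.dist y z) ∧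
      (∀ x ∈ K, |F x - g x| ≤ (L + 1) * ε / 2) ∧
      ∀ x ∈ K, LipNear e F x
        ((1 + ε) * (lipConst d g (@Metric.ball X d.toPseudoMetricSpace x (4 * r))).toReal + ε) := by
  set A : X → ℝ → ℝ≥0∞ := fun x s => lipConst d g (@Metric.ball X d.toPseudoMetricSpace x s) with hA
  have hAL : ∀ x s, A x s ≤ ENNReal.ofReal L := fun x s =>
    lipConst_le_ofReal d fun y _ z _ => hg y z
  have hAtop : ∀ x s, A x s ≠ ∞ := fun x s => ne_top_of_le_ne_top ENNReal.ofReal_ne_top (hAL x s)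
  set ℓ : X → ℝ := fun p => (A p (3 * r)).toReal with hℓ
  have hℓ0 : ∀ p, 0 ≤ ℓ p := fun p => ENNReal.toReal_nonneg
  have hℓL : ∀ p, ℓ p ≤ L := fun p => ENNReal.toReal_le_of_le_ofReal hL (hAL p _)
  have hℓg : ∀ p x, d.dist p x < 3 * r → |g p - g x| ≤ ℓ p * d.dist p x := fun p x hpx =>
    abs_sub_le_toReal_lipConst d (hAtop p _) (@Metric.mem_ball_self X d.toPseudoMetricSpace p _ (by linarith))
      ((@Metric.mem_ball' X d.toPseudoMetricSpace _ _ _).2 hpx)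
  have he0 : ∀ x y, 0 ≤ e.dist x y := fun x y => @dist_nonneg X e.toPseudoMetricSpace x y
  have hd0 : ∀ x y, 0 ≤ d.dist x y := fun x y => @dist_nonneg X d.toPseudoMetricSpace x y
  set c : X → ℝ := fun p => (1 + ε) * ℓ p + ε with hc
  have hc0 : ∀ p, 0 ≤ c p := fun p => by have := hℓ0 p; positivity
  have hcL : ∀ p, c p ≤ 2 * L + 1 := fun p => by
    have := hℓ0 p; have := hℓL p; simp only [hc]; nlinarith
  -- A cone with vertex `p`, slightly steeper than `g` is near `p`. The penalty, active only beyond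
  -- distance `r / 2`, excludes remote vertices without changing the slope close to `p`.
  set w : X → X → ℝ := fun p x => g p + (c p * e.dist p x + 4 * L * max (e.dist p x - r / 2) 0) with hw
  have hwlip : ∀ p y z, w p y ≤ w p z + (6 * L + 1) * e.dist y z := by
    intro p y z
    have h1 : e.dist p y ≤ e.dist p z + e.dist y z := by
      have := e.dist_triangle p z y; rw [e.dist_comm z y] at this; exact this
    have h2 : max (e.dist p y - r / 2) 0 ≤ max (e.dist p z - r / 2) 0 + e.dist y z := by
      have := he0 y z
      refine max_le ?_ (add_nonneg (le_max_right _ _) this)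
      have := le_max_left (e.dist p z - r / 2) 0
      linarith
    have h3 := mul_le_mul_of_nonneg_left h1 (hc0 p)
    have h4 := mul_le_mul_of_nonneg_left h2 (by positivity : 0 ≤ 4 * L)
    have h5 := mul_le_mul_of_nonneg_right (hcL p) (he0 y z)
    simp only [hw]
    nlinarith
  -- the finite net
  set δ : ℝ := min (r / 4) (ε * r / (8 * (3 * L + 1))) with hδ
  have hδ0 : 0 < δ := by positivity
  have hδr : δ < r / 2 := (min_le_left _ _).trans_lt (by linarith)
  -- The factor collects `L` from the variation of `g` and `2 * L + 1` from the cone. The error `ε *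
  -- r / 8` stays below the margin `ε * r / 2` by which far vertices lose.
  have hδε : (3 * L + 1) * δ ≤ ε * r / 8 := by
    have : δ ≤ ε * r / (8 * (3 * L + 1)) := min_le_right _ _
    calc (3 * L + 1) * δ ≤ (3 * L + 1) * (ε * r / (8 * (3 * L + 1))) := by gcongr
      _ = ε * r / 8 := by field_simp
  obtain ⟨P, hPK, hPnet⟩ : ∃ P : Finset X, (↑P ⊆ K) ∧ ∀ x ∈ K, ∃ p ∈ P, d.dist p x < δ := by
    obtain ⟨t, htK, htf, ht⟩ := @Metric.finite_approx_of_totallyBounded X d.toPseudoMetricSpace K hK δ hδ0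
    refine ⟨htf.toFinset, by simpa using htK, fun x hx => ?_⟩
    obtain ⟨p, hp, hpx⟩ := Set.mem_iUnion₂.1 (ht hx)
    exact ⟨p, by simpa using hp, (@Metric.mem_ball' X d.toPseudoMetricSpace _ _ _).1 hpx⟩
  have hPne : P.Nonempty := by
    obtain ⟨x, hx⟩ := hne
    obtain ⟨p, hp, -⟩ := hPnet x hx
    exact ⟨p, hp⟩
  set F : X → ℝ := fun x => P.inf' hPne fun p => w p x with hF
  have hFle : ∀ p ∈ P, ∀ x, F x ≤ w p x := fun p hp x => Finset.inf'_le (fun p => w p x) hp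
  have hFex : ∀ x, ∃ p ∈ P, F x = w p x := fun x => Finset.exists_mem_eq_inf' hPne _
  have hFlip' : ∀ y z, F y ≤ F z + (6 * L + 1) * e.dist y z := by
    intro y z
    obtain ⟨p, hp, hpz⟩ := hFex z
    rw [hpz]
    exact (hFle p hp y).trans (hwlip p y z)
  have hFlip : ∀ y z, |F y - F z| ≤ (6 * L + 1) * e.dist y z := by
    intro y z
    have h1 := hFlip' y z
    have h2 := hFlip' z y
    rw [e.dist_comm z y] at h2
    exact abs_le.2 ⟨by linarith, by linarith⟩
  -- far points are not minimizers
  have hfar : ∀ p ∈ K, ∀ x ∈ K, r / 2 ≤ e.dist p x → g x + ε * r / 2 ≤ w p x := by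
    intro p hp x hx hpx
    -- At distance at least `r / 2` the additive error `ε * r / 2` becomes a relative one.
    have hθ : d.dist p x ≤ (1 + ε) * e.dist p x := by
      have := hde p hp x hx
      nlinarith
    have hmax0 : 0 ≤ max (e.dist p x - r / 2) 0 := le_max_right _ _
    rcases le_or_gt (e.dist p x) r with h | h
    · have h1 : d.dist p x < 3 * r := by nlinarith
      have h2 := (abs_le.1 (hℓg p x h1)).1
      have h3 := mul_le_mul_of_nonneg_left hθ (hℓ0 p)
      have h4 : 0 ≤ 4 * L * max (e.dist p x - r / 2) 0 := by positivity
      simp only [hw, hc]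
      nlinarith
    -- Here the local constant at `p` may be too small, but the penalty beats the global one: `4 *
    -- (t - r / 2) ≥ 2 * t ≥ (1 + ε) * t` for `t > r`.
    · have h2 := (abs_le.1 (hg p x)).1
      have h3 := mul_le_mul_of_nonneg_left hθ hL
      have h4 := mul_le_mul_of_nonneg_left (le_max_left (e.dist p x - r / 2) 0)
        (by positivity : 0 ≤ 4 * L)
      have h5 : ε * e.dist p x ≤ c p * e.dist p x := by
        refine mul_le_mul_of_nonneg_right ?_ (he0 _ _)
        have := hℓ0 p
        simp only [hc]; nlinarith
      have h6 : L * ((1 + ε) * e.dist p x) ≤ 4 * L * (e.dist p x - r / 2) := by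
        have : (1 + ε) * e.dist p x ≤ 4 * (e.dist p x - r / 2) := by nlinarith [he0 p x]
        nlinarith
      simp only [hw]
      nlinarith
  have hnear : ∀ p ∈ K, ∀ x ∈ K, e.dist p x < r / 2 → g x - L * ε / 2 ≤ w p x := by
    intro p hp x hx hpx
    have hθ := hde p hp x hx
    have h1 : d.dist p x < 3 * r := by nlinarith
    have h2 := (abs_le.1 (hℓg p x h1)).1
    have h3 := mul_le_mul_of_nonneg_left hθ (hℓ0 p)
    have h4 : 0 ≤ 4 * L * max (e.dist p x - r / 2) 0 :=
      mul_nonneg (by positivity) (le_max_right _ _)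
    have h5 : ℓ p * (ε * r / 2) ≤ L * ε / 2 := by
      have : ℓ p * (ε * r / 2) ≤ L * (ε * 1 / 2) := by
        have := hℓL p
        gcongr
      linarith
    have h6 : 0 ≤ ε * ℓ p * e.dist p x := by have := hℓ0 p; have := he0 p x; positivity
    have h7 : 0 ≤ ε * e.dist p x := by have := he0 p x; positivity
    simp only [hw, hc]
    nlinarith
  have hupper : ∀ x ∈ K, F x ≤ g x + ε * r / 8 := by
    intro x hx
    obtain ⟨q, hq, hqx⟩ := hPnet x hx
    have h1 : e.dist q x ≤ δ := (hed q x).trans hqx.le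
    have h2 := (abs_le.1 (hg q x)).2
    have h3 : max (e.dist q x - r / 2) 0 = 0 := max_eq_right (by linarith)
    have h4 := mul_le_mul_of_nonneg_left hqx.le hL
    have h5 : c q * e.dist q x ≤ (2 * L + 1) * δ := mul_le_mul (hcL q) h1 (he0 _ _) (by positivity)
    refine (hFle q hq x).trans ?_
    simp only [hw, h3]
    linarith
  refine ⟨F, hFlip, fun x hx => ?_, fun x hx => ?_⟩
  · have hεr : ε * r ≤ ε := by nlinarith
    refine abs_le.2 ⟨?_, ?_⟩
    · obtain ⟨p, hp, hpx⟩ := hFex x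
      rw [hpx]
      rcases lt_or_ge (e.dist p x) (r / 2) with h | h
      · have := hnear p (hPK hp) x hx h; nlinarith
      · have := hfar p (hPK hp) x hx h
        have : 0 < ε * r := by positivity
        nlinarith
    · have := hupper x hx; nlinarith
  -- Near vertices stay near and far ones keep losing strictly. These open conditions hold on a
  -- common neighbourhood because the net is finite.
  · have hev : ∀ᶠ z in @nhds X (topologyOf e) x, ∀ p ∈ P,
        (e.dist p x < r / 2 → e.dist p z < r / 2) ∧ (r / 2 ≤ e.dist p x → F z < w p z) := by
      let := e
      have hFc : Continuous F := (LipschitzWith.of_dist_le_mul (K := (6 * L + 1).toNNReal)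
        fun y z => by rw [Real.coe_toNNReal _ (by positivity)]; exact hFlip y z).continuous
      rw [Filter.eventually_all_finset]
      intro p hp
      have hwc : Continuous (w p) := by simp only [hw]; fun_prop
      rcases lt_or_ge (e.dist p x) (r / 2) with h | h
      · have : ∀ᶠ z in 𝓝 x, dist p z < r / 2 :=
          (continuous_const.dist continuous_id).continuousAt.eventually_lt continuousAt_const h
        filter_upwards [this] with z hz
        exact ⟨fun _ => hz, fun h' => absurd h (not_lt.2 h')⟩
      · have hlt : F x < w p x := by
          have h1 := hfar p (hPK hp) x hx h
          have h2 := hupper x hx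
          have : 0 < ε * r := by positivity
          linarith
        filter_upwards [hFc.continuousAt.eventually_lt hwc.continuousAt hlt] with z hz
        exact ⟨fun h' => absurd h' (not_lt.2 h), fun _ => hz⟩
    obtain ⟨ρ, hρ, hball⟩ := (@Metric.eventually_nhds_iff X e.toPseudoMetricSpace _ _).1 hev
    refine ⟨ρ, hρ, ?_⟩
    set Γ : ℝ := (1 + ε) * (A x (4 * r)).toReal + ε with hΓ
    have key : ∀ y z, e.dist x y < ρ → e.dist x z < ρ → F y - F z ≤ Γ * e.dist y z := by
      intro y z hy hz
      rw [e.dist_comm] at hy hz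
      have hy := hball hy
      have hz := hball hz
      obtain ⟨p, hp, hpz⟩ := hFex z
      have hpx : e.dist p x < r / 2 := by
        by_contra h
        exact absurd hpz ((hz p hp).2 (not_lt.1 h)).ne
      have h1 := (hz p hp).1 hpx
      have h2 := (hy p hp).1 hpx
      have m1 : max (e.dist p z - r / 2) 0 = 0 := max_eq_right (by linarith)
      have m2 : max (e.dist p y - r / 2) 0 = 0 := max_eq_right (by linarith)
      have h3 : F y ≤ g p + c p * e.dist p y := by
        have := hFle p hp y
        simpa only [hw, m2, mul_zero, add_zero] using this
      have h4 : F z = g p + c p * e.dist p z := by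
        simpa only [hw, m1, mul_zero, add_zero] using hpz
      have h5 : e.dist p y ≤ e.dist p z + e.dist y z := by
        have := e.dist_triangle p z y; rw [e.dist_comm z y] at this; exact this
      have h6 := mul_le_mul_of_nonneg_left h5 (hc0 p)
      have h7 : c p ≤ Γ := by
        -- The vertex satisfies `d.dist p x < r`, so its ball of radius `3 * r` lies in the ball of
        -- radius `4 * r` about `x`.
        have : ℓ p ≤ (A x (4 * r)).toReal := by
          refine ENNReal.toReal_mono (hAtop _ _) (lipConst_mono d g ?_)
          refine @Metric.ball_subset_ball' X d.toPseudoMetricSpace _ _ _ _ ?_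
          have := hde p (hPK hp) x hx
          have : ε * r ≤ r := by nlinarith
          linarith
        simp only [hc, hΓ]
        gcongr
      have h8 := mul_le_mul_of_nonneg_right h7 (he0 y z)
      linarith
    intro y z hy hz
    have h1 := key y z hy hz
    have h2 := key z y hz hy
    rw [e.dist_comm z y] at h2
    exact abs_le.2 ⟨by linarith, by linarith⟩

end

/-! ### Cutoffs and truncation. -/

section

variable {X : Type*}

/-- A cutoff function of height `A`, equal to `A` on the ball of radius `R - 1` and to `0` outside
the ball of radius `R`. -/
noncomputable def bump (e : MetricSpace X) (x₀ : X) (A R : ℝ) (x : X) : ℝ :=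
  A * max 0 (min 1 (R - dist x₀ x))

section bump

variable (e : MetricSpace X) (x₀ : X) {A R : ℝ}

lemma bump_nonneg (hA : 0 ≤ A) (x : X) : 0 ≤ bump e x₀ A R x :=
  mul_nonneg hA (le_max_left _ _)

lemma bump_le (hA : 0 ≤ A) (x : X) : bump e x₀ A R x ≤ A :=
  mul_le_of_le_one_right hA (max_le zero_le_one (min_le_left _ _))

lemma bump_eq_zero {x : X} (hx : R ≤ dist x₀ x) : bump e x₀ A R x = 0 := by
  rw [bump, max_eq_left ((min_le_right _ _).trans (by linarith)), mul_zero]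

lemma bump_eq {x : X} (hx : dist x₀ x ≤ R - 1) : bump e x₀ A R x = A := by
  rw [bump, min_eq_left (by linarith), max_eq_right zero_le_one, mul_one]

lemma abs_bump_sub_le (hA : 0 ≤ A) (x y : X) :
    |bump e x₀ A R x - bump e x₀ A R y| ≤ A * dist x y := by
  rw [bump, bump, ← mul_sub, abs_mul, abs_of_nonneg hA]
  refine mul_le_mul_of_nonneg_left ?_ hA
  have h1 := abs_max_sub_max_le_max 0 (min 1 (R - dist x₀ x)) 0 (min 1 (R - dist x₀ y))
  have h2 := abs_min_sub_min_le_max 1 (R - dist x₀ x) 1 (R - dist x₀ y)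
  have h3 : |R - dist x₀ x - (R - dist x₀ y)| ≤ dist x y := by
    rw [show R - dist x₀ x - (R - dist x₀ y) = dist y x₀ - dist x x₀ by
      rw [dist_comm y, dist_comm x]; ring, dist_comm x y]
    exact abs_dist_sub_le y x x₀
  simp only [sub_self, abs_zero] at h1 h2
  exact h1.trans (max_le dist_nonneg (h2.trans (max_le dist_nonneg h3)))

end bump

/-- Truncation of `t` to the interval `[-a, a]`. -/
noncomputable def clip (a t : ℝ) : ℝ := max (-a) (min t a)

lemma abs_clip_le {a : ℝ} (ha : 0 ≤ a) (t : ℝ) : |clip a t| ≤ a :=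
  abs_le.2 ⟨le_max_left _ _, max_le (by linarith) (min_le_right _ _)⟩

lemma clip_eq {a t : ℝ} (h : |t| ≤ a) : clip a t = t := by
  rw [clip, min_eq_left (abs_le.1 h).2, max_eq_right (abs_le.1 h).1]

lemma abs_clip_sub_clip_le {a b s t c : ℝ} (hab : |a - b| ≤ c) (hst : |s - t| ≤ c) :
    |clip a s - clip b t| ≤ c := by
  refine (abs_max_sub_max_le_max _ _ _ _).trans (max_le ?_ ?_)
  · rw [show -a - -b = -(a - b) by ring, abs_neg]; exact hab
  · exact (abs_min_sub_min_le_max _ _ _ _).trans (max_le hst hab)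

/-- Soft thresholding `t - clip κ t` is monotone with increments at most those of `t`. It thus
removes small values without raising any local Lipschitz constant. -/
lemma abs_sub_clip_sub_le (κ s t : ℝ) :
    |(s - clip κ s) - (t - clip κ t)| ≤ |s - t| := by
  wlog hst : t ≤ s generalizing s t
  · rw [abs_sub_comm, abs_sub_comm s t]; exact this t s (le_of_not_ge hst)
  have h1 : clip κ t ≤ clip κ s := max_le_max le_rfl (min_le_min hst le_rfl)
  have h2 : |clip κ s - clip κ t| ≤ |s - t| := abs_clip_sub_clip_le (by simp) le_rfl
  rw [abs_of_nonneg (sub_nonneg.2 h1), abs_of_nonneg (sub_nonneg.2 hst)] at h2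
  rw [abs_of_nonneg (sub_nonneg.2 hst)]
  exact abs_le.2 ⟨by linarith, by linarith⟩

lemma clip_zero (a : ℝ) (ha : 0 ≤ a) : clip a 0 = 0 := clip_eq (by simpa using ha)

/-- A Lipschitz function close, on a set `K`, to a bounded function with bounded support can be
truncated to one with bounded support, without increasing its local Lipschitz constants on `K`. -/
lemma exists_truncation (e : MetricSpace X) (x₀ : X) {K : Set X} {F g : X → ℝ} {C M R κ : ℝ}
    (hF : ∀ x y, |F x - F y| ≤ C * dist x y) (hM : 0 ≤ M) (hg : ∀ x, |g x| ≤ M)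
    (hgR : ∀ x, R < dist x₀ x → g x = 0) (hκ : 0 < κ) (hFg : ∀ x ∈ K, |F x - g x| ≤ κ) :
    ∃ h : X → ℝ, (∀ x y, |h x - h y| ≤ max C (M + κ + 1) * dist x y) ∧
      (∀ x, |h x| ≤ M + κ + 1) ∧ (∀ x, R + 2 ≤ dist x₀ x → h x = 0) ∧
      (∀ x ∈ K, |h x - g x| ≤ 3 * κ) ∧
      ∀ x ∈ K, ∀ Γ, 0 ≤ Γ → LipNear e F x Γ → LipNear e h x Γ := by
  -- The extra `1` makes `|F| < A` strict on `K`, hence valid nearby. The cutoff of radius `R + 2`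
  -- equals `A` up to radius `R + 1`.
  set A := M + κ + 1 with hA
  have hA0 : 0 ≤ A := by positivity
  set ψ : X → ℝ := bump e x₀ A (R + 2) with hψ
  have hψ0 : ∀ x, 0 ≤ ψ x := bump_nonneg e x₀ hA0
  -- At points of `K` where `g` vanishes, `|F| ≤ κ`. The threshold `2 * κ` therefore makes `T`
  -- vanish on a whole neighbourhood.
  set T : X → ℝ := fun x => F x - clip (2 * κ) (F x) with hT
  have hTF : ∀ x y, |T x - T y| ≤ |F x - F y| := fun x y => abs_sub_clip_sub_le _ _ _
  have hT0 : ∀ x, |T x| ≤ |F x| := fun x => by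
    have := abs_sub_clip_sub_le (2 * κ) (F x) 0
    rwa [clip_zero _ (by positivity), sub_zero, sub_zero, sub_zero] at this
  have hFcont : Continuous F := (LipschitzWith.of_dist_le' hF).continuous
  have hdcont : Continuous fun y => dist x₀ y := continuous_const.dist continuous_id
  -- near points of `K`, either nothing is cut or everything is
  have hloc : ∀ x ∈ K, ∃ ρ > 0, (∀ y, dist x y < ρ → clip (ψ y) (T y) = T y) ∨
      ((∀ y, dist x y < ρ → clip (ψ y) (T y) = 0) ∧ g x = 0) := by
    intro x hx
    rcases lt_or_ge (dist x₀ x) (R + 1) with h | h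
    · have hFx : |F x| < A := by
        have h1 := abs_sub_abs_le_abs_sub (F x) (g x)
        have h2 := hFg x hx
        have h3 := hg x
        linarith
      have h1 := hdcont.continuousAt.eventually_lt continuousAt_const h
      have h2 := hFcont.abs.continuousAt.eventually_lt continuousAt_const hFx
      obtain ⟨ρ, hρ, hball⟩ := Metric.eventually_nhds_iff.1 (h1.and h2)
      refine ⟨ρ, hρ, Or.inl fun y hy => ?_⟩
      rw [dist_comm] at hy
      obtain ⟨h1, h2⟩ := hball hy
      refine clip_eq ((hT0 y).trans ?_)
      rw [hψ, bump_eq e x₀ (by linarith)]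
      exact h2.le
    · have hgx := hgR x (by linarith)
      have hFx : |F x| < 2 * κ := by
        have := hFg x hx
        rw [hgx, sub_zero] at this
        linarith
      have h2 := hFcont.abs.continuousAt.eventually_lt continuousAt_const hFx
      obtain ⟨ρ, hρ, hball⟩ := Metric.eventually_nhds_iff.1 h2
      refine ⟨ρ, hρ, Or.inr ⟨fun y hy => ?_, hgx⟩⟩
      rw [dist_comm] at hy
      have h2 := hball hy
      have : T y = 0 := by simp only [hT]; rw [clip_eq h2.le, sub_self]
      rw [this, clip_zero _ (hψ0 y)]
  refine ⟨fun x => clip (ψ x) (T x), fun x y => ?_, fun x => ?_, fun x hx => ?_, fun x hx => ?_,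
    fun x hx Γ hΓ hFx => ?_⟩
  · refine abs_clip_sub_clip_le ((abs_bump_sub_le e x₀ hA0 x y).trans ?_)
      (((hTF x y).trans (hF x y)).trans ?_)
    · exact mul_le_mul_of_nonneg_right (le_max_right _ _) dist_nonneg
    · exact mul_le_mul_of_nonneg_right (le_max_left _ _) dist_nonneg
  · exact (abs_clip_le (hψ0 x) _).trans (bump_le e x₀ hA0 x)
  · have : |clip (ψ x) (T x)| ≤ 0 := by
      refine (abs_clip_le (hψ0 x) _).trans ?_
      rw [hψ, bump_eq_zero e x₀ hx]
    exact abs_eq_zero.1 (le_antisymm this (abs_nonneg _))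
  · obtain ⟨ρ, hρ, h | ⟨h, hgx⟩⟩ := hloc x hx
    · simp only
      rw [h x (by simpa using hρ)]
      have h1 : |clip (2 * κ) (F x)| ≤ 2 * κ := abs_clip_le (by positivity) _
      have h2 := hFg x hx
      calc |T x - g x| = |(F x - g x) - clip (2 * κ) (F x)| := by simp only [hT]; ring_nf
        _ ≤ |F x - g x| + |clip (2 * κ) (F x)| := abs_sub _ _
        _ ≤ 3 * κ := by linarith
    · simp only
      rw [h x (by simpa using hρ), hgx, sub_zero, abs_zero]
      positivity
  · obtain ⟨ρ, hρ, h | ⟨h, -⟩⟩ := hloc x hx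
    · refine LipNear.congr ?_ hρ h
      obtain ⟨r, hr, H⟩ := hFx
      exact ⟨r, hr, fun y z hy hz => (hTF y z).trans (H y z hy hz)⟩
    · refine ⟨ρ, hρ, fun y z hy hz => ?_⟩
      simp only
      rw [h y hy, h z hz, sub_zero, abs_zero]
      exact mul_nonneg hΓ dist_nonneg

end

/-! ### From pointwise bounds to L² distance and energy. -/

section

variable {X : Type*} [MeasurableSpace X] {m : Measure X}

lemma IsBoundedlySupportedLipschitz.measurable {e : MetricSpace X}
    (he : IsMetricMeasureSpace e m) {h : X → ℝ} (hh : IsBoundedlySupportedLipschitz e h) :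
    Measurable h := by
  have := he.borel
  exact hh.1.choose_spec.continuous.measurable

/-- Quantitative comparison: a function `h` that is close to a representative `g` of `f` on most of
a set `S` of finite measure gives an element of `L²` close to `f` with controlled energy. -/
lemma exists_Lp_edist_le_asymptoticEnergy_le {e : MetricSpace X} (he : IsMetricMeasureSpace e m)
    {f : Lp ℝ 2 m} {g h : X → ℝ} (hfg : f =ᵐ[m] g) (hg : Measurable g)
    (hh : IsBoundedlySupportedLipschitz e h) {S K : Set X} (hS : MeasurableSet S)
    (hK : MeasurableSet K) (hmS : m S < ∞) {κ C C' : ℝ}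
    (hκ : 0 ≤ κ) (hhgK : ∀ x ∈ K, |h x - g x| ≤ κ) (hhgC : ∀ x, |h x - g x| ≤ C')
    (hhgS : ∀ x ∉ S, h x = g x) (hC : ∀ x, asymptoticSlope e h x ≤ ENNReal.ofReal C)
    (hCS : ∀ x ∉ S, asymptoticSlope e h x = 0) {G : X → ℝ≥0∞}
    (hG : ∀ x ∈ K, asymptoticSlope e h x ≤ G x) :
    ∃ u : Lp ℝ 2 m, edist u f ≤
        ENNReal.ofReal κ * m S ^ (1 / 2 : ℝ) + ENNReal.ofReal C' * m (S \ K) ^ (1 / 2 : ℝ) ∧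
      asymptoticEnergy e m u ≤
        1 / 2 * (∫⁻ x in K, G x ^ 2 ∂m + ENNReal.ofReal C ^ 2 * m (S \ K)) := by
  have hhm := hh.measurable he
  have hSK : MeasurableSet (S \ K) := hS.diff hK
  have hmSK : m (S \ K) < ∞ := (measure_mono Set.sdiff_subset).trans_lt hmS
  have hbound : eLpNorm (h - g) 2 m ≤
      ENNReal.ofReal κ * m S ^ (1 / 2 : ℝ) + ENNReal.ofReal C' * m (S \ K) ^ (1 / 2 : ℝ) := by
    have hC'0 : ∀ x : X, 0 ≤ C' := fun x => (abs_nonneg _).trans (hhgC x)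
    have h1 : eLpNorm (h - g) 2 m ≤
        eLpNorm ((S.indicator fun _ => κ) + (S \ K).indicator fun _ => C') 2 m := by
      refine eLpNorm_mono_real fun x => ?_
      rw [Pi.sub_apply, Real.norm_eq_abs, Pi.add_apply]
      by_cases hxS : x ∈ S
      · by_cases hxK : x ∈ K
        · simpa [hxS, hxK] using hhgK x hxK
        · have := hhgC x
          simp only [Set.indicator_of_mem hxS, Set.indicator_of_mem (Set.mem_sdiff_of_mem hxS hxK)]
          linarith
      · simp [hxS, hhgS x hxS]
    refine h1.trans ((eLpNorm_add_le ?_ ?_ (by norm_num)).trans ?_)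
    · exact (measurable_const.indicator hS).aestronglyMeasurable
    · exact (measurable_const.indicator hSK).aestronglyMeasurable
    · rw [eLpNorm_indicator_const hS (by norm_num) (by norm_num),
        eLpNorm_indicator_const hSK (by norm_num) (by norm_num)]
      rcases isEmpty_or_nonempty X with hX | ⟨⟨x⟩⟩
      · simp [Measure.eq_zero_of_isEmpty m]
      · rw [Real.enorm_of_nonneg hκ, Real.enorm_of_nonneg (hC'0 x)]
        norm_num
  have hmem : MemLp (h - g) 2 m := by
    refine ⟨(hhm.sub hg).aestronglyMeasurable, hbound.trans_lt ?_⟩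
    refine ENNReal.add_lt_top.2 ⟨?_, ?_⟩ <;>
    exact ENNReal.mul_lt_top ENNReal.ofReal_lt_top (ENNReal.rpow_lt_top_of_nonneg (by norm_num)
      (by first | exact hmS.ne | exact hmSK.ne))
  -- This is the class of `h`, written so that its distance to `f` is the norm of `h - g`.
  refine ⟨f + hmem.toLp, ?_, ?_⟩
  · rw [edist_eq_enorm_sub, add_sub_cancel_left, Lp.enorm_toLp]
    exact hbound
  · have hrep : (f + hmem.toLp : Lp ℝ 2 m) =ᵐ[m] h := by
      filter_upwards [Lp.coeFn_add f hmem.toLp, hmem.coeFn_toLp, hfg] with x h1 h2 h3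
      rw [h1, Pi.add_apply, h2, h3, Pi.sub_apply]
      ring
    refine (iInf_le_of_le h (iInf₂_le_of_le hh hrep le_rfl)).trans ?_
    refine mul_le_mul_right ?_ _
    calc ∫⁻ x, asymptoticSlope e h x ^ 2 ∂m
        ≤ ∫⁻ x, K.indicator (fun x => G x ^ 2) x +
            (S \ K).indicator (fun _ => ENNReal.ofReal C ^ 2) x ∂m := by
          refine lintegral_mono fun x => ?_
          by_cases hxS : x ∈ S
          · by_cases hxK : x ∈ K
            · rw [Set.indicator_of_mem hxK]
              exact le_add_right (pow_le_pow_left' (hG x hxK) 2)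
            · rw [Set.indicator_of_mem (Set.mem_sdiff_of_mem hxS hxK)]
              exact le_add_left (pow_le_pow_left' (hC x) 2)
          · simp [hCS x hxS]
      _ = _ := by
          rw [lintegral_add_right _ (measurable_const.indicator hSK), lintegral_indicator hK,
            lintegral_indicator_const hSK]

end

/-! ### Relaxation, and monotonicity of the Cheeger energy in the distance. -/

section

variable {X : Type*} [MeasurableSpace X] {m : Measure X}

lemma cheegerEnergy_le_asymptoticEnergy (d : MetricSpace X) (f : Lp ℝ 2 m) :
    cheegerEnergy d m f ≤ asymptoticEnergy d m f :=
  iInf₂_le_of_le (fun _ => f) tendsto_const_nhds (by simp)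

lemma exists_asymptoticEnergy_lt {d : MetricSpace X} {f : Lp ℝ 2 m} {c ε : ℝ≥0∞}
    (h : cheegerEnergy d m f < c) (hε : 0 < ε) :
    ∃ u, edist u f < ε ∧ asymptoticEnergy d m u < c := by
  simp only [cheegerEnergy, iInf_lt_iff] at h
  obtain ⟨u, hu, h⟩ := h
  have h1 := frequently_lt_of_liminf_lt (by isBoundedDefault) h
  have h2 : ∀ᶠ n in atTop, edist (u n) f < ε := (EMetric.tendsto_nhds.1 hu) ε hε
  obtain ⟨n, hn⟩ := (h1.and_eventually h2).exists
  exact ⟨u n, hn.2, hn.1⟩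

lemma cheegerEnergy_le_of_asymptoticEnergy_lt {d : MetricSpace X} {f : Lp ℝ 2 m} {c : ℝ≥0∞}
    (h : ∀ ε : ℝ≥0∞, 0 < ε → ∃ u, edist u f < ε ∧ asymptoticEnergy d m u < c) :
    cheegerEnergy d m f ≤ c := by
  choose u hu hc using fun n : ℕ => h (n : ℝ≥0∞)⁻¹ (by simp)
  refine iInf₂_le_of_le u ?_ (liminf_le_of_frequently_le' (Frequently.of_forall fun n => (hc n).le))
  refine tendsto_iff_edist_tendsto_0.2 ?_
  exact tendsto_of_tendsto_of_tendsto_of_le_of_le tendsto_const_nhds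
    ENNReal.tendsto_inv_nat_nhds_zero (fun _ => zero_le) fun n => (hu n).le

/-- A diagonal argument: relaxing a second time gives nothing smaller. This is the source of lower
semicontinuity. -/
lemma cheegerEnergy_le_of_cheegerEnergy_lt {d : MetricSpace X} {f : Lp ℝ 2 m} {c : ℝ≥0∞}
    (h : ∀ ε : ℝ≥0∞, 0 < ε → ∃ u, edist u f < ε ∧ cheegerEnergy d m u < c) :
    cheegerEnergy d m f ≤ c := by
  refine cheegerEnergy_le_of_asymptoticEnergy_lt fun ε hε => ?_
  obtain ⟨u, hu, huc⟩ := h (ε / 2) (ENNReal.half_pos hε.ne')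
  obtain ⟨v, hv, hvc⟩ := exists_asymptoticEnergy_lt huc (ENNReal.half_pos hε.ne')
  refine ⟨v, (edist_triangle v u f).trans_lt ?_, hvc⟩
  exact (ENNReal.add_lt_add hv hu).trans_eq (ENNReal.add_halves ε)

lemma lowerSemicontinuous_cheegerEnergy (d : MetricSpace X) (m : Measure X) :
    LowerSemicontinuous (cheegerEnergy d m) := by
  intro f c hc
  obtain ⟨b, hcb, hb⟩ := exists_between hc
  by_contra hcon
  rw [Filter.not_eventually] at hcon
  refine absurd hb (not_lt.2 (cheegerEnergy_le_of_cheegerEnergy_lt fun ε hε => ?_))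
  obtain ⟨u, hu, huε⟩ := (hcon.and_eventually (Metric.eball_mem_nhds f hε)).exists
  exact ⟨u, huε, (not_lt.1 hu).trans_lt hcb⟩

lemma asymptoticEnergy_of_isEmpty [IsEmpty X] (d : MetricSpace X) (f : Lp ℝ 2 m) :
    asymptoticEnergy d m f = 0 := by
  refine le_antisymm (iInf_le_of_le 0 (iInf₂_le_of_le ⟨⟨0, fun x => isEmptyElim x⟩, ?_⟩ ?_ ?_))
    zero_le
  · rw [Set.eq_empty_of_isEmpty (Function.support _)]
    exact Bornology.isBounded_empty
  · exact Eventually.of_forall fun x => isEmptyElim x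
  · simp [Measure.eq_zero_of_isEmpty m]

/-- The strict inequalities leave room for an exceptional set of small measure `t`. The tolerance
`η` is fixed before that set is chosen. -/
lemma exists_pos_forall_le_lt {a b ε I C C' : ℝ≥0∞} (ha : a < ε) (hI : 1 / 2 * I < b)
    (hC : C ≠ ∞) (hC' : C' ≠ ∞) :
    ∃ η : ℝ≥0∞, 0 < η ∧ ∀ t < η, a + C' * t ^ (1 / 2 : ℝ) < ε ∧ 1 / 2 * (I + C ^ 2 * t) < b := by
  have h1 : Tendsto (fun t : ℝ≥0∞ => a + C' * t ^ (1 / 2 : ℝ)) (𝓝 0) (𝓝 a) := by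
    have := (ENNReal.continuous_rpow_const (y := (1 / 2 : ℝ))).tendsto 0
    rw [ENNReal.zero_rpow_of_pos (by norm_num)] at this
    simpa using tendsto_const_nhds.add (ENNReal.Tendsto.const_mul (a := C') this (Or.inr hC'))
  have h2 : Tendsto (fun t : ℝ≥0∞ => 1 / 2 * (I + C ^ 2 * t)) (𝓝 0) (𝓝 (1 / 2 * I)) := by
    have h := ENNReal.Tendsto.const_mul (a := C ^ 2) (tendsto_id (x := 𝓝 (0 : ℝ≥0∞)))
      (Or.inr (ENNReal.pow_ne_top hC))
    have h' := (tendsto_const_nhds (x := I)).add h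
    have h'' := ENNReal.Tendsto.const_mul (a := 1 / 2) h' (Or.inr (by norm_num))
    simpa using h''
  have h3 := (h1.eventually (gt_mem_nhds ha)).and (h2.eventually (gt_mem_nhds hI))
  obtain ⟨η, hη, h⟩ := ENNReal.nhds_zero_basis.eventually_iff.1 h3
  exact ⟨η, hη, fun t ht => h ht⟩

lemma IsMetricMeasureSpace.measurable_dist {d : MetricSpace X} (hd : IsMetricMeasureSpace d m)
    (x₀ : X) : Measurable fun x => d.dist x₀ x := by
  have := hd.borel
  exact (continuous_const.dist continuous_id).measurable

lemma IsMetricMeasureSpace.measure_dist_le_lt_top {d : MetricSpace X}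
    (hd : IsMetricMeasureSpace d m) (x₀ : X) (R : ℝ) : m {x | d.dist x₀ x ≤ R} < ∞ :=
  hd.finite_of_isBounded _ ((Metric.isBounded_closedBall (x := x₀) (r := R)).subset fun _ hx =>
    Metric.mem_closedBall'.2 hx)

/-- Enlarging the distance decreases the Cheeger energy. -/
lemma cheegerEnergy_anti {d' d : MetricSpace X} (hd' : IsMetricMeasureSpace d' m)
    (hd : IsMetricMeasureSpace d m) (hdd : ∀ x y, d'.dist x y ≤ d.dist x y) (f : Lp ℝ 2 m) :
    cheegerEnergy d m f ≤ cheegerEnergy d' m f := by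
  refine le_of_forall_gt_imp_ge_of_dense fun b hb =>
    cheegerEnergy_le_of_cheegerEnergy_lt fun ε hε => ?_
  obtain ⟨v, hv, hvb⟩ := exists_asymptoticEnergy_lt hb hε
  refine ⟨v, hv, lt_of_le_of_lt ?_ hvb⟩
  rcases isEmpty_or_nonempty X with hX | ⟨⟨x₀⟩⟩
  · exact (cheegerEnergy_le_asymptoticEnergy d v).trans
      ((asymptoticEnergy_of_isEmpty d v).trans_le zero_le)
  refine le_iInf fun g => le_iInf₂ fun hg hvg => ?_
  refine le_of_forall_gt_imp_ge_of_dense fun b hb =>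
    cheegerEnergy_le_of_asymptoticEnergy_lt fun ε hε => ?_
  obtain ⟨L, M, R, hL, hM, hR, hgL, hgM, hgR⟩ := hg.exists_bounds x₀
  have hgLd : ∀ x y, |g x - g y| ≤ L * d.dist x y := fun x y =>
    (hgL x y).trans (mul_le_mul_of_nonneg_left (hdd x y) hL)
  set S : Set X := {x | d'.dist x₀ x ≤ R} with hS
  have hSm : MeasurableSet S := measurableSet_le (hd'.measurable_dist x₀) measurable_const
  have hmS : m S < ∞ := hd'.measure_dist_le_lt_top x₀ R
  set K : ℕ → Set X := fun n => S ∩ {x | d.dist x₀ x < n} with hK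
  have hKm : ∀ n, MeasurableSet (K n) := fun n =>
    hSm.inter (measurableSet_lt (hd.measurable_dist x₀) measurable_const)
  have hlim : Tendsto (fun n => m (S \ K n)) atTop (𝓝 0) := by
    have hempty : ⋂ n, S \ K n = ∅ := by
      refine Set.eq_empty_of_forall_notMem fun x hx => ?_
      obtain ⟨n, hn⟩ := exists_nat_gt (d.dist x₀ x)
      obtain ⟨h1, h2⟩ := Set.mem_iInter.1 hx n
      exact h2 ⟨h1, hn⟩
    have := tendsto_measure_iInter_atTop (μ := m) (s := fun n => S \ K n)
      (fun n => (hSm.diff (hKm n)).nullMeasurableSet)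
      (fun a b hab => Set.sdiff_subset_sdiff_right (Set.inter_subset_inter_right _
        (Set.ofPred_subset_ofPred.2 fun x hx => hx.trans_le (Nat.cast_le.2 hab))))
      ⟨0, ((measure_mono Set.sdiff_subset).trans_lt hmS).ne⟩
    rwa [hempty, measure_empty] at this
  obtain ⟨η, hη, hη'⟩ := exists_pos_forall_le_lt (a := 0) hε hb
    (ENNReal.ofReal_ne_top (r := max L M)) (ENNReal.ofReal_ne_top (r := 2 * M))
  obtain ⟨n, hn⟩ := (hlim.eventually (gt_mem_nhds hη)).exists
  -- The support of `g` is `d'`-bounded but perhaps not `d`-bounded. Clipping at height `ψ`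
  -- preserves `g` where `d.dist x₀ x < n`, with a Lipschitz constant independent of `n`.
  set ψ : X → ℝ := bump d x₀ M (n + 1) with hψ
  have hψ0 : ∀ x, 0 ≤ ψ x := bump_nonneg d x₀ hM
  have hψM : ∀ x, ψ x ≤ M := bump_le d x₀ hM
  set h : X → ℝ := fun x => clip (ψ x) (g x) with hh
  have hhL : ∀ x y, |h x - h y| ≤ max L M * d.dist x y := by
    have hd0 : ∀ x y, 0 ≤ d.dist x y := fun x y => @dist_nonneg X d.toPseudoMetricSpace x y
    refine fun x y => abs_clip_sub_clip_le ((abs_bump_sub_le d x₀ hM x y).trans ?_)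
      ((hgLd x y).trans ?_)
    · exact mul_le_mul_of_nonneg_right (le_max_right _ _) (hd0 x y)
    · exact mul_le_mul_of_nonneg_right (le_max_left _ _) (hd0 x y)
  have hhg : ∀ x, d.dist x₀ x < n → h x = g x := by
    intro x hx
    refine clip_eq ?_
    rw [hψ, bump_eq d x₀ (by linarith)]
    exact hgM x
  have hh0 : ∀ x, g x = 0 → h x = 0 := by
    intro x hx
    simp only [hh, hx]
    exact clip_zero _ (hψ0 x)
  have hhb : IsBoundedlySupportedLipschitz d h := by
    refine isBoundedlySupportedLipschitz_of_abs_sub_le d (hL.trans (le_max_left _ M)) hhL x₀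
      (R := n + 1) fun x hx => ?_
    have h1 := abs_clip_le (hψ0 x) (g x)
    have h2 : ψ x = 0 := bump_eq_zero d x₀ hx.le
    refine abs_eq_zero.1 (le_antisymm (h1.trans h2.le) (abs_nonneg _))
  obtain ⟨u, hu1, hu2⟩ := exists_Lp_edist_le_asymptoticEnergy_le hd hvg (hg.measurable hd') hhb hSm
    (hKm n) hmS le_rfl (C := max L M) (C' := 2 * M) (G := asymptoticSlope d' g)
    (fun x hx => by rw [hhg x hx.2, sub_self, abs_zero])
    (fun x => by
      have h1 := abs_clip_le (hψ0 x) (g x)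
      have h2 := hgM x
      have h3 := abs_sub (h x) (g x)
      have h4 := hψM x
      linarith)
    (fun x hx => by rw [hgR x (not_le.1 hx), hh0 x (hgR x (not_le.1 hx))])
    (fun x => LipNear.asymptoticSlope_le ⟨1, one_pos, fun y z _ _ => hhL y z⟩)
    (fun x hx => by
      refine le_antisymm ((asymptoticSlope_anti hdd h x).trans ?_) zero_le
      have hx' : 0 < d'.dist x₀ x - R := sub_pos.2 (not_le.1 hx)
      refine (LipNear.asymptoticSlope_le (Γ := 0) ⟨_, hx', fun y z hy hz => ?_⟩).trans (by simp)
      have key : ∀ y, d'.dist x y < d'.dist x₀ x - R → h y = 0 := fun y hy => by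
        refine hh0 y (hgR y ?_)
        have := d'.dist_triangle x₀ y x
        rw [d'.dist_comm y x] at this
        linarith
      rw [key y hy, key z hz, sub_self, abs_zero, zero_mul])
    (fun x hx => by
      have hx' : 0 < n - d.dist x₀ x := sub_pos.2 hx.2
      refine (asymptoticSlope_le_of_eqOn_ball hx' fun y hy => hhg y ?_).trans
        (asymptoticSlope_anti hdd g x)
      have := d.dist_triangle x₀ x y
      linarith)
  obtain ⟨h1, h2⟩ := hη' _ hn
  refine ⟨u, hu1.trans_lt (by simpa using h1), hu2.trans_lt (lt_of_le_of_lt ?_ h2)⟩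
  gcongr
  exact Measure.restrict_le_self

end

/-! ### Recovery of the `d`-energy by the approximating distances. -/

section

variable {X : Type*}

/-- Dini: the distances `dseq i` converge to `d` uniformly on `d`-compact sets. -/
lemma exists_forall_dist_le_add {d : MetricSpace X} {dseq : ℕ → MetricSpace X}
    (hmono : ∀ x y : X, Monotone fun i => (dseq i).dist x y)
    (hlim : ∀ x y : X, Tendsto (fun i => (dseq i).dist x y) atTop (𝓝 (d.dist x y)))
    {K : Set X} (hK : @IsCompact X (topologyOf d) K) {θ : ℝ} (hθ : 0 < θ) :
    ∃ i, ∀ x ∈ K, ∀ y ∈ K, d.dist x y ≤ (dseq i).dist x y + θ := by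
  have hle : ∀ i x y, (dseq i).dist x y ≤ d.dist x y := fun i x y =>
    (hmono x y).ge_of_tendsto (hlim x y) i
  have hcont : ∀ i, @Continuous (X × X) ℝ (@instTopologicalSpaceProd X X (topologyOf d)
      (topologyOf d)) _ fun p => (dseq i).dist p.1 p.2 := by
    intro i
    let := d
    -- Each variable contributes constant `1`, because `dseq i` is bounded by `d`.
    refine (LipschitzWith.of_dist_le_mul (K := 2) fun p q => ?_).continuous
    have tri := (dseq i).dist_triangle
    have com := (dseq i).dist_comm
    have h1 : d.dist p.1 q.1 ≤ dist p q := le_max_left _ _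
    have h2 : d.dist p.2 q.2 ≤ dist p q := le_max_right _ _
    have h3 := hle i p.1 q.1
    have h4 := hle i p.2 q.2
    rw [Real.dist_eq, NNReal.coe_ofNat, abs_le]
    constructor
    · have a1 := tri q.1 p.1 q.2
      have a2 := tri p.1 p.2 q.2
      rw [com q.1 p.1] at a1
      linarith
    · have a1 := tri p.1 q.1 p.2
      have a2 := tri q.1 q.2 p.2
      rw [com q.2 p.2] at a2
      linarith
  have hu := @Monotone.tendstoUniformlyOn_of_forall_tendsto ℕ (X × X) ℝ _
    (@instTopologicalSpaceProd X X (topologyOf d) (topologyOf d)) _ _ _ _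
    (fun i p => (dseq i).dist p.1 p.2) (fun p => d.dist p.1 p.2) (K ×ˢ K)
    (@IsCompact.prod X X (topologyOf d) (topologyOf d) K K hK hK)
    (fun i => (hcont i).continuousOn) (fun p _ => hmono p.1 p.2)
    (continuous_dist.continuousOn) (fun p _ => hlim p.1 p.2)
  obtain ⟨i, hi⟩ := (Metric.tendstoUniformlyOn_iff.1 hu θ hθ).exists
  refine ⟨i, fun x hx y hy => ?_⟩
  have := hi (x, y) ⟨hx, hy⟩
  rw [Real.dist_eq] at this
  have := (abs_lt.1 this).2
  simp only at this
  linarith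

variable [MeasurableSpace X] {m : Measure X}

lemma IsMetricMeasureSpace.exists_isCompact_measure_diff_lt {d : MetricSpace X}
    (hd : IsMetricMeasureSpace d m) {S : Set X} (hS : MeasurableSet S) (hmS : m S < ∞) {η : ℝ≥0∞}
    (hη : 0 < η) : ∃ K ⊆ S, IsCompact K ∧ m (S \ K) < η := by
  have := hd.complete
  have := hd.separable
  have := hd.borel
  have : SecondCountableTopology X := UniformSpace.secondCountable_of_separable X
  have : IsFiniteMeasure (m.restrict S) := ⟨by simpa using hmS⟩
  obtain ⟨K, hKS, hK, h⟩ := hS.exists_isCompact_sdiff_lt (μ := m.restrict S) (measure_ne_top _ _)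
    hη.ne'
  refine ⟨K, hKS, hK, ?_⟩
  rwa [Measure.restrict_apply (hS.diff hK.measurableSet),
    Set.inter_eq_left.2 Set.sdiff_subset] at h

lemma ofReal_one_add_mul_toReal_add {t : ℝ≥0∞} (ht : t ≠ ∞) {ε : ℝ} (hε : 0 ≤ ε) :
    ENNReal.ofReal ((1 + ε) * t.toReal + ε) =
      ENNReal.ofReal (1 + ε) * t + ENNReal.ofReal ε := by
  rw [ENNReal.ofReal_add (by positivity) hε, ENNReal.ofReal_mul (by positivity),
    ENNReal.ofReal_toReal ht]

/-- The integral of the relaxed squared Lipschitz constants at small scale converges to the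
integral of the squared asymptotic slope. -/
lemma tendsto_setLIntegral_lipConst_ball {d : MetricSpace X} (hd : IsMetricMeasureSpace d m)
    {g : X → ℝ} {L : ℝ} (hg : ∀ x y, |g x - g y| ≤ L * d.dist x y) {S : Set X} (hmS : m S < ∞)
    {ε : ℕ → ℝ} (hε : ∀ n, 0 < ε n) (hε1 : ∀ n, ε n ≤ 1) (hanti : Antitone ε)
    (hlim : Tendsto ε atTop (𝓝 0)) :
    Tendsto (fun n => ∫⁻ x in S, (ENNReal.ofReal (1 + ε n) *
        lipConst d g (Metric.ball x (4 * ε n)) + ENNReal.ofReal (ε n)) ^ 2 ∂m) atTop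
      (𝓝 (∫⁻ x in S, asymptoticSlope d g x ^ 2 ∂m)) := by
  have := hd.borel
  refine tendsto_lintegral_of_dominated_convergence
    (fun _ => (ENNReal.ofReal 2 * ENNReal.ofReal L + ENNReal.ofReal 1) ^ 2) (fun n => ?_)
    (fun n => Eventually.of_forall fun x => ?_) ?_ (Eventually.of_forall fun x => ?_)
  · exact ((((lowerSemicontinuous_lipConst_ball d g _).measurable).const_mul _).add_const _).pow_const 2
  · have := hε1 n
    simp only
    gcongr
    · linarith
    · exact lipConst_le_ofReal d fun y _ z _ => hg y z
  · rw [setLIntegral_const]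
    exact (ENNReal.mul_lt_top (ENNReal.pow_lt_top (by finiteness)) hmS).ne
  · have h1 := tendsto_lipConst_ball d g x (r := fun n => 4 * ε n)
      (fun n => by have := hε n; positivity) (fun a b hab => by have := hanti hab; simp only; linarith)
      (by simpa using hlim.const_mul 4)
    have h2 : Tendsto (fun n => ENNReal.ofReal (1 + ε n)) atTop (𝓝 1) := by
      have := ENNReal.tendsto_ofReal (hlim.const_add 1)
      simpa using this
    have h3 : Tendsto (fun n => ENNReal.ofReal (ε n)) atTop (𝓝 0) := by
      have := ENNReal.tendsto_ofReal hlim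
      simpa using this
    have h4 := (ENNReal.Tendsto.mul h2 (Or.inl one_ne_zero) h1 (Or.inr ENNReal.one_ne_top)).add h3
    rw [one_mul, add_zero] at h4
    exact ((ENNReal.continuous_pow 2).tendsto _).comp h4

/-- Recovery: the asymptotic energy of `d` is approximated by those of the distances `dseq i`. -/
lemma exists_asymptoticEnergy_dseq_lt {d : MetricSpace X} (hd : IsMetricMeasureSpace d m)
    {dseq : ℕ → MetricSpace X} (hdseq : ∀ i, IsMetricMeasureSpace (dseq i) m)
    (hmono : ∀ x y : X, Monotone fun i => (dseq i).dist x y)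
    (hlim : ∀ x y : X, Tendsto (fun i => (dseq i).dist x y) atTop (𝓝 (d.dist x y)))
    {f : Lp ℝ 2 m} {b ε : ℝ≥0∞} (hb : asymptoticEnergy d m f < b) (hε : 0 < ε) :
    ∃ i u, edist u f < ε ∧ asymptoticEnergy (dseq i) m u < b := by
  rcases isEmpty_or_nonempty X with hX | ⟨⟨x₀⟩⟩
  · exact ⟨0, f, by simpa using hε, by
      rw [asymptoticEnergy_of_isEmpty] at hb ⊢; exact hb⟩
  simp only [asymptoticEnergy, iInf_lt_iff] at hb
  obtain ⟨g, hg, hfg, hb⟩ := hb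
  have hle : ∀ i x y, (dseq i).dist x y ≤ d.dist x y := fun i x y =>
    (hmono x y).ge_of_tendsto (hlim x y) i
  have hle0 : ∀ i x y, (dseq 0).dist x y ≤ (dseq i).dist x y := fun i x y =>
    hmono x y (Nat.zero_le i)
  obtain ⟨L, M, R, hL, hM, hR, hgL, hgM, hgR⟩ := hg.exists_bounds x₀
  -- A ball of the smallest distance has finite measure and contains the ball of the same radius for
  -- every `dseq i`. It contains the supports of the approximants before `i` is known.
  set S : Set X := {x | (dseq 0).dist x₀ x ≤ R + 2} with hS
  have hSm : MeasurableSet S := measurableSet_le ((hdseq 0).measurable_dist x₀) measurable_const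
  have hmS : m S < ∞ := (hdseq 0).measure_dist_le_lt_top x₀ _
  have hx₀S : x₀ ∈ S := by
    have := (dseq 0).dist_self x₀
    simp only [hS, Set.mem_ofPred_eq, this]; positivity
  -- the scale
  obtain ⟨s, hs0, hs1, hs2, hs3⟩ : ∃ s : ℝ, 0 < s ∧ s ≤ 1 ∧
      ENNReal.ofReal (3 * ((L + 1) * s / 2)) * m S ^ (1 / 2 : ℝ) < ε ∧
      1 / 2 * ∫⁻ x in S, (ENNReal.ofReal (1 + s) *
        lipConst d g (Metric.ball x (4 * s)) + ENNReal.ofReal s) ^ 2 ∂m < b := by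
    set e : ℕ → ℝ := fun n => 1 / ((n : ℝ) + 1) with he
    have he0 : ∀ n, 0 < e n := fun n => Nat.one_div_pos_of_nat
    have he1 : Antitone e := fun a b hab => Nat.one_div_le_one_div hab
    have he2 : Tendsto e atTop (𝓝 0) := tendsto_one_div_add_atTop_nhds_zero_nat
    have he3 : ∀ n, e n ≤ 1 := fun n => (he1 (Nat.zero_le n)).trans (by simp [he])
    have h1 := tendsto_setLIntegral_lipConst_ball hd hgL hmS he0 he3 he1 he2
    have h2 := ENNReal.Tendsto.const_mul (a := 1 / 2) h1 (Or.inr (by norm_num))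
    have h3 : 1 / 2 * ∫⁻ x in S, asymptoticSlope d g x ^ 2 ∂m < b :=
      lt_of_le_of_lt (mul_le_mul_right (setLIntegral_le_lintegral _ _) _) hb
    have h4 : Tendsto (fun n => ENNReal.ofReal (3 * ((L + 1) * e n / 2)) * m S ^ (1 / 2 : ℝ))
        atTop (𝓝 0) := by
      have h5 : Tendsto (fun n => 3 * ((L + 1) * e n / 2)) atTop (𝓝 0) := by
        simpa using ((he2.const_mul (L + 1)).div_const 2).const_mul 3
      have h6 := ENNReal.tendsto_ofReal h5
      rw [ENNReal.ofReal_zero] at h6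
      simpa using ENNReal.Tendsto.mul_const h6 (Or.inr
        (ENNReal.rpow_lt_top_of_nonneg (by norm_num) hmS.ne).ne)
    obtain ⟨n, hn1, hn2⟩ := ((h2.eventually (gt_mem_nhds h3)).and
      (h4.eventually (gt_mem_nhds hε))).exists
    exact ⟨e n, he0 n, he3 n, hn2, hn1⟩
  set κ : ℝ := (L + 1) * s / 2 with hκ
  have hκ0 : 0 < κ := by positivity
  -- This bounds the global Lipschitz constant after truncation, independently of `i` and `K`, so
  -- both may be chosen later.
  set C : ℝ := max (6 * L + 1) (M + κ + 1) with hC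
  obtain ⟨η, hη, hη'⟩ := exists_pos_forall_le_lt hs2 hs3
    (ENNReal.ofReal_ne_top (r := C)) (ENNReal.ofReal_ne_top (r := 2 * M + κ + 1))
  obtain ⟨K₁, hK₁S, hK₁, hK₁η⟩ := hd.exists_isCompact_measure_diff_lt hSm hmS hη
  -- Adding the base point only ensures that `K` is nonempty.
  set K : Set X := insert x₀ K₁ with hKdef
  have hK : @IsCompact X (topologyOf d) K := @IsCompact.insert X (topologyOf d) K₁ hK₁ x₀
  have hKS : K ⊆ S := Set.insert_subset hx₀S hK₁S
  have hKm : MeasurableSet K := by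
    have := hd.borel
    exact IsCompact.measurableSet hK
  -- The single scale `s` plays the roles of both `ε` and `r` in the cone construction.
  obtain ⟨i, hi⟩ := exists_forall_dist_le_add hmono hlim hK (θ := s * s / 2) (by positivity)
  obtain ⟨F, hFlip, hFg, hFloc⟩ := exists_discrete_infConvolution d (dseq i)
    (@IsCompact.totallyBounded X d.toUniformSpace K hK) ⟨x₀, Set.mem_insert _ _⟩ (hle i) hL hgL
    hs0 hs1 hs0 hs1 hi
  obtain ⟨h, hhL, hhM, hhR, hhg, hhloc⟩ := exists_truncation (dseq i) x₀ hFlip hM hgM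
    (fun x hx => hgR x (hx.trans_le (hle i x₀ x))) hκ0 hFg
  have hhb : IsBoundedlySupportedLipschitz (dseq i) h :=
    isBoundedlySupportedLipschitz_of_abs_sub_le (dseq i)
      ((by positivity : 0 ≤ 6 * L + 1).trans (le_max_left _ _)) hhL x₀ fun x hx => hhR x hx.le
  have hout : ∀ x ∉ S, R + 2 < (dseq i).dist x₀ x := fun x hx =>
    (not_le.1 hx).trans_le (hle0 i x₀ x)
  obtain ⟨u, hu1, hu2⟩ := exists_Lp_edist_le_asymptoticEnergy_le (hdseq i) hfg (hg.measurable hd)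
    hhb hSm hKm hmS (κ := 3 * κ) (by positivity) hhg (C := C) (C' := 2 * M + κ + 1)
    (G := fun x => ENNReal.ofReal (1 + s) *
        lipConst d g (@Metric.ball X d.toPseudoMetricSpace x (4 * s)) + ENNReal.ofReal s)
    (fun x => by
      have h1 := hhM x
      have h2 := hgM x
      have h3 := abs_sub (h x) (g x)
      linarith)
    (fun x hx => by
      have h1 := hout x hx
      rw [hhR x h1.le, hgR x (by have := hle i x₀ x; linarith)])
    (fun x => LipNear.asymptoticSlope_le ⟨1, one_pos, fun y z _ _ => hhL y z⟩)
    (fun x hx => by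
      have hx' : 0 < (dseq i).dist x₀ x - (R + 2) := sub_pos.2 (hout x hx)
      refine le_antisymm ((LipNear.asymptoticSlope_le (Γ := 0)
        ⟨_, hx', fun y z hy hz => ?_⟩).trans (by simp)) zero_le
      have key : ∀ y, (dseq i).dist x y < (dseq i).dist x₀ x - (R + 2) → h y = 0 := fun y hy => by
        refine hhR y ?_
        have := (dseq i).dist_triangle x₀ y x
        rw [(dseq i).dist_comm y x] at this
        linarith
      rw [key y hy, key z hz, sub_self, abs_zero, zero_mul])
    (fun x hx => by
      have htop : lipConst d g (@Metric.ball X d.toPseudoMetricSpace x (4 * s)) ≠ ∞ :=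
        ne_top_of_le_ne_top ENNReal.ofReal_ne_top (lipConst_le_ofReal d fun y _ z _ => hgL y z)
      refine (hhloc x hx _ (by positivity) (hFloc x hx)).asymptoticSlope_le.trans_eq ?_
      exact ofReal_one_add_mul_toReal_add htop hs0.le)
  have hmK : m (S \ K) < η :=
    (measure_mono (Set.sdiff_subset_sdiff_right (Set.subset_insert _ _))).trans_lt hK₁η
  obtain ⟨h1, h2⟩ := hη' _ hmK
  refine ⟨i, u, hu1.trans_lt h1, hu2.trans_lt (lt_of_le_of_lt ?_ h2)⟩
  gcongr

end

/-! ### Quadratic forms from a one-sided parallelogram law. -/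

section

/-- The weights are chosen so that the cross terms `2 * s * ⟨u, v⟩` and `-2 * s * ⟨u, v⟩` cancel. -/
lemma core_inner_identity {V : Type*} [AddCommGroup V] [Module ℝ V] (c : InnerProductSpace.Core ℝ V)
    (s : ℝ) (u v : V) :
    s * c.inner (u + v) (u + v) + c.inner (s • u - v) (s • u - v) =
      s * (1 + s) * c.inner u u + (1 + s) * c.inner v v := by
  have symm : ∀ x y, c.inner x y = c.inner y x := fun x y => (c.conj_inner_symm x y).symm
  have add_right : ∀ x y z, c.inner x (y + z) = c.inner x y + c.inner x z := fun x y z => by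
    rw [symm, c.add_left, symm y, symm z]
  have smul_left : ∀ x y (r : ℝ), c.inner (r • x) y = r * c.inner x y := fun x y r =>
    c.smul_left x y r
  have smul_right : ∀ x y (r : ℝ), c.inner x (r • y) = r * c.inner x y := fun x y r => by
    rw [symm, smul_left, symm]
  rw [show s • u - v = s • u + (-1 : ℝ) • v by rw [neg_one_smul, sub_eq_add_neg]]
  simp only [c.add_left, add_right, smul_left, smul_right, symm v u]
  ring

/-- A nonnegative function satisfying a one-sided weighted parallelogram law is the square of the
norm of an inner product. -/
lemma exists_core_of_weighted_parallelogram_le {V : Type*} [AddCommGroup V] [Module ℝ V]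
    {Q : V → ℝ} (hQ : ∀ x, 0 ≤ Q x) (hQ0 : ∀ x, Q x = 0 ↔ x = 0)
    (hpar : ∀ s : ℝ, 0 < s → ∀ u v,
      s * Q (u + v) + Q (s • u - v) ≤ s * (1 + s) * Q u + (1 + s) * Q v) :
    ∃ c : InnerProductSpace.Core ℝ V, ∀ x, Q x = c.inner x x := by
  have hz : Q 0 = 0 := (hQ0 0).2 rfl
  have hneg : ∀ x, Q (-x) = Q x := by
    have h : ∀ x, Q (-x) ≤ Q x := fun x => by
      have := hpar 1 one_pos 0 x
      simp only [zero_add, smul_zero, zero_sub, hz] at this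
      linarith
    exact fun x => le_antisymm (h x) (by simpa using h (-x))
  have hpos : ∀ s : ℝ, 0 < s → ∀ x, Q (s • x) = s ^ 2 * Q x := by
    have h : ∀ s : ℝ, 0 < s → ∀ x, Q (s • x) ≤ s ^ 2 * Q x := fun s hs x => by
      have := hpar s hs x 0
      simp only [add_zero, sub_zero, hz] at this
      linarith
    refine fun s hs x => le_antisymm (h s hs x) ?_
    have := h s⁻¹ (inv_pos.2 hs) (s • x)
    rw [smul_smul, inv_mul_cancel₀ hs.ne', one_smul] at this
    calc s ^ 2 * Q x ≤ s ^ 2 * (s⁻¹ ^ 2 * Q (s • x)) := by gcongr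
      _ = Q (s • x) := by field_simp
  have hsmul : ∀ (s : ℝ) x, Q (s • x) = s ^ 2 * Q x := by
    intro s x
    rcases lt_trichotomy s 0 with h | h | h
    · rw [← hneg, ← neg_smul, hpos (-s) (neg_pos.2 h), neg_sq]
    · simp [h, hz]
    · exact hpos s h x
  have htri : ∀ x y, √(Q (x + y)) ≤ √(Q x) + √(Q y) := by
    intro x y
    rcases eq_or_ne x 0 with rfl | hx
    · simp [hz]
    rcases eq_or_ne y 0 with rfl | hy
    · simp [hz]
    have hx' : 0 < √(Q x) := Real.sqrt_pos.2 ((hQ x).lt_of_ne' (mt (hQ0 x).1 hx))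
    have hy' : 0 < √(Q y) := Real.sqrt_pos.2 ((hQ y).lt_of_ne' (mt (hQ0 y).1 hy))
    refine Real.sqrt_le_iff.2 ⟨by positivity, ?_⟩
    -- With `a = √(Q x)`, `b = √(Q y)` this is the optimal weight: `(1 + s) * a ^ 2 + (1 + s⁻¹) * b
    -- ^ 2 = (a + b) ^ 2` at `s = b / a`.
    have h1 := hpar (√(Q y) / √(Q x)) (by positivity) x y
    have h2 := hQ ((√(Q y) / √(Q x)) • x - y)
    have h3 : √(Q y) / √(Q x) * Q (x + y) ≤ √(Q y) / √(Q x) * (√(Q x) + √(Q y)) ^ 2 := by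
      refine (le_of_add_le_of_nonneg_left h1 h2).trans_eq ?_
      have hx2 := Real.sq_sqrt (hQ x)
      have hy2 := Real.sq_sqrt (hQ y)
      set a := √(Q x)
      set b := √(Q y)
      rw [← hx2, ← hy2]
      field_simp
    exact le_of_mul_le_mul_left h3 (by positivity)
  have hparL : ∀ x y, Q (x + y) + Q (x - y) ≤ 2 * (Q x + Q y) := fun x y => by
    have := hpar 1 one_pos x y
    rw [one_smul] at this
    linarith
  have hparE : ∀ x y, Q (x + y) + Q (x - y) = 2 * (Q x + Q y) := by
    refine fun x y => le_antisymm (hparL x y) ?_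
    -- Substituting sum and difference, with homogeneity, reverses the inequality.
    have := hparL (x + y) (x - y)
    rw [show x + y + (x - y) = (2 : ℝ) • x by rw [two_smul]; abel,
      show x + y - (x - y) = (2 : ℝ) • y by rw [two_smul]; abel, hsmul, hsmul] at this
    linarith
  let _ : Norm V := ⟨fun x => √(Q x)⟩
  have core : NormedSpace.Core ℝ V :=
    { norm_nonneg := fun x => Real.sqrt_nonneg _
      norm_smul := fun s x => by
        change √(Q (s • x)) = |s| * √(Q x)
        rw [hsmul, Real.sqrt_mul (sq_nonneg s), Real.sqrt_sq_eq_abs]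
      norm_triangle := htri
      norm_eq_zero_iff := fun x => by
        change √(Q x) = 0 ↔ x = 0
        rw [Real.sqrt_eq_zero (hQ x), hQ0] }
  let _ : NormedAddCommGroup V := NormedAddCommGroup.ofCore core
  let _ : NormedSpace ℝ V := NormedSpace.ofCore core
  have hnorm : ∀ x : V, ‖x‖ * ‖x‖ = Q x := fun x => Real.mul_self_sqrt (hQ x)
  -- The Jordan–von Neumann theorem.
  let I : InnerProductSpace ℝ V := InnerProductSpace.ofNorm ℝ fun x y => by
    rw [hnorm, hnorm, hnorm, hnorm, hparE]
  exact ⟨I.toCore, fun x => by rw [← hnorm]; exact (real_inner_self_eq_norm_mul_norm x).symm⟩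

/-! ### Passing the weighted parallelogram law to the limit distance. -/

variable {X : Type*} [MeasurableSpace X] {m : Measure X}

lemma cheegerEnergy_zero (d : MetricSpace X) (m : Measure X) : cheegerEnergy d m 0 = 0 := by
  refine le_antisymm ((cheegerEnergy_le_asymptoticEnergy d 0).trans ?_) zero_le
  refine iInf_le_of_le 0 (iInf₂_le_of_le ⟨⟨0, LipschitzWith.const 0⟩, ?_⟩ (Lp.coeFn_zero _ _ _) ?_)
  · rw [Function.support_zero]
    exact Bornology.isBounded_empty
  · have : ∀ x, asymptoticSlope d 0 x = 0 := fun x => le_antisymm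
      ((LipNear.asymptoticSlope_le (Γ := 0) ⟨1, one_pos, fun y z _ _ => by simp⟩).trans (by simp))
      zero_le
    simp [this]

lemma sobolevNorm_sq (d : MetricSpace X) (f : Lp ℝ 2 m) :
    sobolevNorm d m f ^ 2 = ‖f‖ ^ 2 + 2 * (cheegerEnergy d m f).toReal :=
  Real.sq_sqrt (by positivity)

lemma norm_weighted_parallelogram {H : Type*} [NormedAddCommGroup H] [InnerProductSpace ℝ H]
    (s : ℝ) (u v : H) :
    s * ‖u + v‖ ^ 2 + ‖s • u - v‖ ^ 2 = s * (1 + s) * ‖u‖ ^ 2 + (1 + s) * ‖v‖ ^ 2 := by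
  rw [norm_add_sq_real, norm_sub_sq_real, norm_smul, inner_smul_left, mul_pow, Real.norm_eq_abs,
    sq_abs]
  simp only [conj_trivial]
  ring

/-- On an infinitesimally Hilbertian space, the Cheeger energy satisfies a weighted parallelogram
law. -/
lemma IsInfinitesimallyHilbertian.cheegerEnergy_identity {d : MetricSpace X}
    (h : IsInfinitesimallyHilbertian d m) {u v : Lp ℝ 2 m} (hu : cheegerEnergy d m u < ∞)
    (hv : cheegerEnergy d m v < ∞) {s : ℝ} (hs : 0 < s) :
    ENNReal.ofReal s * cheegerEnergy d m (u + v) + cheegerEnergy d m (s • u - v) =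
      ENNReal.ofReal (s * (1 + s)) * cheegerEnergy d m u +
        ENNReal.ofReal (1 + s) * cheegerEnergy d m v := by
  obtain ⟨W, hW, ⟨c, hc⟩, -⟩ := h
  have hu' := (hW u).2 hu
  have hv' := (hW v).2 hv
  have h1 := (hW _).1 (W.add_mem hu' hv')
  have h2 := (hW _).1 (W.sub_mem (W.smul_mem s hu') hv')
  have hid := core_inner_identity c s ⟨u, hu'⟩ ⟨v, hv'⟩
  rw [← hc, ← hc, ← hc, ← hc, sobolevNorm_sq, sobolevNorm_sq, sobolevNorm_sq, sobolevNorm_sq] at hid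
  simp only [Submodule.coe_add, Submodule.coe_sub, Submodule.coe_smul] at hid
  -- Subtracting the L² identity from the Sobolev one leaves twice the identity for the energies.
  have hid' := norm_weighted_parallelogram s u v
  rw [← ENNReal.toReal_eq_toReal_iff' (by finiteness) (by finiteness),
    ENNReal.toReal_add (by finiteness) (by finiteness),
    ENNReal.toReal_add (by finiteness) (by finiteness)]
  simp only [ENNReal.toReal_mul]
  rw [ENNReal.toReal_ofReal hs.le, ENNReal.toReal_ofReal (by positivity),
    ENNReal.toReal_ofReal (by positivity)]
  linarith

/-- The left side only decreases on passing from `dseq i` to `d` and is lower semicontinuous in L².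
Recovery makes the right side nearly optimal. -/
lemma cheegerEnergy_weighted_parallelogram_le {d : MetricSpace X} (hd : IsMetricMeasureSpace d m)
    {dseq : ℕ → MetricSpace X} (hdseq : ∀ i, IsMetricMeasureSpace (dseq i) m)
    (hmono : ∀ x y : X, Monotone fun i => (dseq i).dist x y)
    (hlim : ∀ x y : X, Tendsto (fun i => (dseq i).dist x y) atTop (𝓝 (d.dist x y)))
    (hH : ∀ i, IsInfinitesimallyHilbertian (dseq i) m) (f g : Lp ℝ 2 m) {s : ℝ} (hs : 0 < s) :
    ENNReal.ofReal s * cheegerEnergy d m (f + g) + cheegerEnergy d m (s • f - g) ≤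
      ENNReal.ofReal (s * (1 + s)) * cheegerEnergy d m f +
        ENNReal.ofReal (1 + s) * cheegerEnergy d m g := by
  have happrox : ∀ f : Lp ℝ 2 m, ∀ b ε : ℝ≥0∞, cheegerEnergy d m f < b → 0 < ε →
      ∃ i u, edist u f < ε ∧ ∀ j ≥ i, cheegerEnergy (dseq j) m u < b := by
    intro f b ε hb hε
    obtain ⟨u, hu, hub⟩ := exists_asymptoticEnergy_lt hb (ENNReal.half_pos hε.ne')
    obtain ⟨i, v, hv, hvb⟩ := exists_asymptoticEnergy_dseq_lt hd hdseq hmono hlim hub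
      (ENNReal.half_pos hε.ne')
    refine ⟨i, v, (edist_triangle v u f).trans_lt ?_, fun j hj => ?_⟩
    · exact (ENNReal.add_lt_add hv hu).trans_eq (ENNReal.add_halves ε)
    · exact ((cheegerEnergy_anti (hdseq i) (hdseq j) (fun x y => hmono x y hj) v).trans
        (cheegerEnergy_le_asymptoticEnergy _ v)).trans_lt hvb
  set Φ : Lp ℝ 2 m × Lp ℝ 2 m → ℝ≥0∞ := fun p =>
    ENNReal.ofReal s * cheegerEnergy d m (p.1 + p.2) + cheegerEnergy d m (s • p.1 - p.2) with hΦ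
  have hlsc : LowerSemicontinuous Φ := by
    have hcomp : ∀ T : Lp ℝ 2 m × Lp ℝ 2 m → Lp ℝ 2 m, Continuous T →
        LowerSemicontinuous fun p => cheegerEnergy d m (T p) := fun T hT p c hc =>
      hT.continuousAt.eventually (lowerSemicontinuous_cheegerEnergy d m (T p) c hc)
    refine LowerSemicontinuous.add ?_ (hcomp _ (by fun_prop))
    exact (ENNReal.continuous_const_mul ENNReal.ofReal_ne_top).comp_lowerSemicontinuous
      (hcomp _ (by fun_prop)) fun a b hab => mul_le_mul_right hab _
  set α := ENNReal.ofReal (s * (1 + s)) with hα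
  set β := ENNReal.ofReal (1 + s) with hβ
  have hα0 : α ≠ 0 := (ENNReal.ofReal_pos.2 (by positivity)).ne'
  have hβ0 : β ≠ 0 := (ENNReal.ofReal_pos.2 (by positivity)).ne'
  rcases eq_or_ne (cheegerEnergy d m f) ∞ with hf | hf
  · rw [hf, ENNReal.mul_top hα0, top_add]; exact le_top
  rcases eq_or_ne (cheegerEnergy d m g) ∞ with hg | hg
  · rw [hg, ENNReal.mul_top hβ0, add_top]; exact le_top
  by_contra! hcon
  have hδ : Tendsto (fun δ : ℝ≥0∞ => α * (cheegerEnergy d m f + δ) + β * (cheegerEnergy d m g + δ))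
      (𝓝[>] 0) (𝓝 (α * cheegerEnergy d m f + β * cheegerEnergy d m g)) := by
    have hid : Tendsto (fun δ : ℝ≥0∞ => δ) (𝓝[>] 0) (𝓝 0) := tendsto_id.mono_left nhdsWithin_le_nhds
    have h : ∀ a b : ℝ≥0∞, a ≠ ∞ → Tendsto (fun δ => a * (b + δ)) (𝓝[>] 0) (𝓝 (a * b)) :=
      fun a b ha => by
        have := ENNReal.Tendsto.const_mul (a := a) (hid.const_add b) (Or.inr ha)
        rwa [add_zero] at this
    exact (h α _ ENNReal.ofReal_ne_top).add (h β _ ENNReal.ofReal_ne_top)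
  obtain ⟨δ, hδ1, hδ0⟩ := ((hδ.eventually (gt_mem_nhds hcon)).and self_mem_nhdsWithin).exists
  have hev := hlsc (f, g) _ hδ1
  obtain ⟨ε, hε, hball⟩ := EMetric.mem_nhds_iff.1 hev
  obtain ⟨i, u, hu, hui⟩ := happrox f _ ε (ENNReal.lt_add_right hf hδ0.ne') hε
  obtain ⟨j, v, hv, hvj⟩ := happrox g _ ε (ENNReal.lt_add_right hg hδ0.ne') hε
  have h1 := hball (show (u, v) ∈ Metric.eball (f, g) ε from max_lt hu hv)
  -- The two approximants come with different indices. Monotonicity of the energies moves both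
  -- bounds to a common index, where the identity applies.
  have hu' := hui _ (le_max_left i j)
  have hv' := hvj _ (le_max_right i j)
  have hmon := cheegerEnergy_anti (hdseq (max i j)) hd fun x y => (hmono x y).ge_of_tendsto (hlim x y) _
  refine absurd (show _ < Φ (u, v) from h1) (not_lt.2 ?_)
  calc Φ (u, v) ≤ ENNReal.ofReal s * cheegerEnergy (dseq (max i j)) m (u + v) +
        cheegerEnergy (dseq (max i j)) m (s • u - v) := by
          simp only [hΦ]
          gcongr
          · exact hmon _
          · exact hmon _
    _ = α * cheegerEnergy (dseq (max i j)) m u + β * cheegerEnergy (dseq (max i j)) m v :=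
        (hH _).cheegerEnergy_identity (hu'.trans_le le_top) (hv'.trans_le le_top) hs
    _ ≤ _ := by gcongr

/-- A space whose Cheeger energy satisfies the weighted parallelogram inequality is infinitesimally
Hilbertian. -/
lemma isInfinitesimallyHilbertian_of_weighted_parallelogram_le {d : MetricSpace X}
    (hpar : ∀ (f g : Lp ℝ 2 m) (s : ℝ), 0 < s →
      ENNReal.ofReal s * cheegerEnergy d m (f + g) + cheegerEnergy d m (s • f - g) ≤
        ENNReal.ofReal (s * (1 + s)) * cheegerEnergy d m f +
          ENNReal.ofReal (1 + s) * cheegerEnergy d m g) :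
    IsInfinitesimallyHilbertian d m := by
  set E := cheegerEnergy d m with hE
  have hE0 : E 0 = 0 := cheegerEnergy_zero d m
  have hfin : ∀ f g : Lp ℝ 2 m, ∀ s : ℝ, 0 < s → E f < ∞ → E g < ∞ →
      E (f + g) < ∞ ∧ E (s • f - g) < ∞ := by
    intro f g s hs hf hg
    have h : ENNReal.ofReal s * E (f + g) + E (s • f - g) < ∞ :=
      (hpar f g s hs).trans_lt (by finiteness)
    obtain ⟨h1, h2⟩ := ENNReal.add_lt_top.1 h
    exact ⟨ENNReal.lt_top_of_mul_ne_top_right h1.ne (ENNReal.ofReal_pos.2 hs).ne', h2⟩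
  have hneg : ∀ f, E f < ∞ → E (-f) < ∞ := fun f hf => by
    have := (hfin 0 f 1 one_pos (by simp [hE0]) hf).2
    rwa [smul_zero, zero_sub] at this
  have hpos : ∀ f (s : ℝ), 0 < s → E f < ∞ → E (s • f) < ∞ := fun f s hs hf => by
    have := (hfin f 0 s hs hf (by simp [hE0])).2
    rwa [sub_zero] at this
  let W : Submodule ℝ (Lp ℝ 2 m) :=
    { carrier := {f | E f < ∞}
      add_mem' := fun {f g} hf hg => (hfin f g 1 one_pos hf hg).1
      zero_mem' := by simp [hE0]
      smul_mem' := fun s f hf => by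
        rcases lt_trichotomy s 0 with h | h | h
        · have := hneg _ (hpos f (-s) (neg_pos.2 h) hf)
          rwa [neg_smul, neg_neg] at this
        · simp [h, hE0]
        · exact hpos f s h hf }
  have hW : ∀ f, f ∈ W ↔ E f < ∞ := fun f => Iff.rfl
  refine ⟨W, hW, ?_, fun u hu => ?_⟩
  · refine exists_core_of_weighted_parallelogram_le (Q := fun f : W => sobolevNorm d m f ^ 2)
      (fun f => sq_nonneg _) (fun f => ⟨fun h => ?_, fun h => ?_⟩) fun s hs u v => ?_
    · have h1 := sobolevNorm_sq d (f : Lp ℝ 2 m)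
      have h2 : 0 ≤ (cheegerEnergy d m (f : Lp ℝ 2 m)).toReal := ENNReal.toReal_nonneg
      have h3 : ‖(f : Lp ℝ 2 m)‖ ^ 2 = 0 := le_antisymm (by linarith) (sq_nonneg _)
      exact Subtype.ext (norm_eq_zero.1 (pow_eq_zero_iff two_ne_zero |>.1 h3))
    · rw [sobolevNorm_sq, h, Submodule.coe_zero, norm_zero, ← hE, hE0]
      simp
    · have h1 := norm_weighted_parallelogram s (u : Lp ℝ 2 m) v
      have hu := (hW _).1 u.2
      have hv := (hW _).1 v.2
      obtain ⟨h2, h3⟩ := hfin _ _ s hs hu hv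
      have h4 := ENNReal.toReal_mono (by finiteness) (hpar u v s hs)
      rw [ENNReal.toReal_add (by finiteness) (by finiteness),
        ENNReal.toReal_add (by finiteness) (by finiteness)] at h4
      simp only [ENNReal.toReal_mul] at h4
      rw [ENNReal.toReal_ofReal hs.le, ENNReal.toReal_ofReal (by positivity),
        ENNReal.toReal_ofReal (by positivity)] at h4
      simp only [sobolevNorm_sq, Submodule.coe_add, Submodule.coe_sub, Submodule.coe_smul, ← hE]
      linarith
  · have hle : ∀ (w : Lp ℝ 2 m) (ε : ℝ), 0 < ε → sobolevNorm d m w < ε → E w < ∞ →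
        ‖w‖ ≤ ε ∧ E w ≤ ENNReal.ofReal (ε ^ 2) := by
      intro w ε hε hw hEw
      have h1 := sobolevNorm_sq d w
      have h2 : sobolevNorm d m w ^ 2 ≤ ε ^ 2 :=
        pow_le_pow_left₀ (Real.sqrt_nonneg _) hw.le 2
      have h3 : 0 ≤ (cheegerEnergy d m w).toReal := ENNReal.toReal_nonneg
      refine ⟨abs_le_of_sq_le_sq' (by nlinarith) hε.le |>.2, ?_⟩
      rw [← ENNReal.ofReal_toReal hEw.ne]
      refine ENNReal.ofReal_le_ofReal ?_
      nlinarith [sq_nonneg ‖w‖]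
    have hmem : ∀ n k, E ((u n : Lp ℝ 2 m) - u k) < ∞ := fun n k => (u n - u k).2
    have hcau : CauchySeq fun n => (u n : Lp ℝ 2 m) := by
      refine Metric.cauchySeq_iff.2 fun ε hε => ?_
      obtain ⟨N, hN⟩ := hu (ε / 2) (half_pos hε)
      refine ⟨N, fun n hn k hk => ?_⟩
      have := (hle _ _ (half_pos hε) (hN n hn k hk) (hmem n k)).1
      rw [dist_eq_norm]
      linarith
    obtain ⟨f, hf⟩ := cauchySeq_tendsto_of_complete hcau
    have hlim : ∀ ε : ℝ, 0 < ε → ∃ N, ∀ n ≥ N,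
        ‖(u n : Lp ℝ 2 m) - f‖ ≤ ε ∧ E ((u n : Lp ℝ 2 m) - f) ≤ ENNReal.ofReal (ε ^ 2) := by
      intro ε hε
      obtain ⟨N, hN⟩ := hu ε hε
      refine ⟨N, fun n hn => ?_⟩
      have ht : Tendsto (fun k => (u n : Lp ℝ 2 m) - u k) atTop (𝓝 (u n - f)) := hf.const_sub _
      have hev : ∀ᶠ k in atTop, ‖(u n : Lp ℝ 2 m) - u k‖ ≤ ε ∧
          E ((u n : Lp ℝ 2 m) - u k) ≤ ENNReal.ofReal (ε ^ 2) := by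
        filter_upwards [eventually_ge_atTop N] with k hk
        exact hle _ _ hε (hN n hn k hk) (hmem n k)
      -- Letting `k` tend to infinity with `n` fixed keeps both bounds, since sublevel sets of the
      -- energy are closed in L².
      exact ⟨le_of_tendsto ht.norm (hev.mono fun _ h => h.1),
        ((lowerSemicontinuous_cheegerEnergy d m).isClosed_preimage _).mem_of_tendsto ht
          (hev.mono fun _ h => h.2)⟩
    have hfW : f ∈ W := by
      obtain ⟨N, hN⟩ := hlim 1 one_pos
      have h1 : (u N : Lp ℝ 2 m) - f ∈ W := (hN N le_rfl).2.trans_lt ENNReal.ofReal_lt_top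
      have h2 := W.sub_mem (u N).2 h1
      rwa [sub_sub_cancel] at h2
    refine ⟨⟨f, hfW⟩, Metric.tendsto_atTop.2 fun ε hε => ?_⟩
    obtain ⟨N, hN⟩ := hlim (ε / 2) (half_pos hε)
    refine ⟨N, fun n hn => ?_⟩
    obtain ⟨h1, h2⟩ := hN n hn
    rw [Real.dist_eq, sub_zero, sobolevNorm, abs_of_nonneg (Real.sqrt_nonneg _)]
    refine (Real.sqrt_lt' hε).2 ?_
    simp only
    have h3 : (E ((u n : Lp ℝ 2 m) - f)).toReal ≤ (ε / 2) ^ 2 :=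
      ENNReal.toReal_le_of_le_ofReal (by positivity) h2
    have h4 : ‖(u n : Lp ℝ 2 m) - f‖ ^ 2 ≤ (ε / 2) ^ 2 := pow_le_pow_left₀ (norm_nonneg _) h1 2
    rw [hE] at h3
    -- The squared Sobolev norm is at most `3 * (ε / 2) ^ 2 < ε ^ 2`.
    nlinarith

end

end CheegerEnergy

theorem corollary4p2 {X : Type*} [MeasurableSpace X] (m : Measure X)
    (d : MetricSpace X) (hd : CheegerEnergy.IsMetricMeasureSpace d m)
    (dseq : ℕ → MetricSpace X)
    (hdseq : ∀ i, CheegerEnergy.IsMetricMeasureSpace (dseq i) m)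
    (hmono : ∀ x y : X, Monotone fun i => (dseq i).dist x y)
    (hlim : ∀ x y : X, Tendsto (fun i => (dseq i).dist x y) atTop (𝓝 (d.dist x y)))
    (htop : ∀ i, CheegerEnergy.topologyOf (dseq i) = CheegerEnergy.topologyOf d)
    (hH : ∀ i, CheegerEnergy.IsInfinitesimallyHilbertian (dseq i) m) :
    CheegerEnergy.IsInfinitesimallyHilbertian d m := by
  exact CheegerEnergy.isInfinitesimallyHilbertian_of_weighted_parallelogram_le fun f g _ hs =>
    CheegerEnergy.cheegerEnergy_weighted_parallelogram_le hd hdseq hmono hlim hH f g hs
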